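/- A *twin pair* is an ordered pair $(\theta,\eta)$ of nonzero pure quaternions $\theta,\eta\in\mathbb{Z}i+\mathbb{Z}j+\mathbb{Z}k$ of equal norm whose product $\theta\eta$ is also pure; equivalently, an ordered pair of nonzero perpendicular vectors of $\mathbb{Z}^3$ of equal length. Here a quaternion $a+bi+cj+dk$ has norm $N(a+bi+cj+dk)=a^2+b^2+c^2+d^2$ and is pure if $a=0$. For a positive integer $M$ let $\mathrm{Twin}(M)$ be the number of twin pairs $(\theta,\eta)$ with $N(\theta)=N(\eta)=M$ (this number is finite), and let $\sigma(s)$ be the sum of the positive divisors of $s$. Let $$M=2^{\kappa}p_1^{\lambda_1}\cdots p_m^{\lambda_m}q_1^{\mu_1}\cdots q_\ell^{\mu_\ell},$$ where $\kappa,m,\ell\ge 0$, the $p_r$ are distinct primes $\equiv 1\pmod 4$, the $q_s$ are distinct primes $\equiv 3\pmod 4$, and all $\lambda_r,\mu_s$ are positive. Then $$\mathrm{Twin}(M)=24\prod_{r=1}^{m}g(p_r^{\lambda_r})\prod_{s=1}^{\ell}h(q_s^{\mu_s}),$$ where $$g(p^{2\lambda})=\sigma(p^{\lambda})+\sigma(p^{\lambda-1})\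 (\lambda\ge 1),\qquad g(p^{2\lambda+1})=2\sigma(p^{\lambda})\ (\lambda\ge 0),$$ $$h(q^{2\mu})=\sigma(q^{\mu})+\sigma(q^{\mu-1})\ (\mu\ge 1),\qquad h(q^{2\mu+1})=0\ (\mu\ge 0).$$ In particular, $\mathrm{Twin}(M)/24$ is a multiplicative function of $M$. If there exists a twin pair with norm $M$, then $M$ is the sum of two squares of integers. -/

import Mathlib

open scoped Quaternion

/-- A quaternion with integer coefficients is *pure* if its trace (twice its real part) is zero. -/
def IsPureQuat (θ : ℍ[ℤ]) : Prop :=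
  θ + star θ = 0

/-- `(θ, η)` is a *twin pair*: `θ` and `η` are nonzero pure quaternions with integer coefficients,
they have the same norm, and `θ * η` is pure as well.  Equivalently, the vectors of `ℤ³` formed by
the coefficients of `i, j, k` are nonzero, of equal length, and perpendicular (the real part of
`θ * η` is minus their dot product).  The norm of `a + b i + c j + d k` is
`Quaternion.normSq`, that is, `a ^ 2 + b ^ 2 + c ^ 2 + d ^ 2`. -/
structure IsTwinPair (θ η : ℍ[ℤ]) : Prop where
  left_ne_zero : θ ≠ 0
  right_ne_zero : η ≠ 0
  left_pure : IsPureQuat θ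
  right_pure : IsPureQuat η
  norm_eq : Quaternion.normSq θ = Quaternion.normSq η
  mul_pure : IsPureQuat (θ * η)

/-- The set of (ordered) twin pairs whose common norm is `M`. -/
def twinPairs (M : ℕ) : Set (ℍ[ℤ] × ℍ[ℤ]) :=
  {x | IsTwinPair x.1 x.2 ∧ Quaternion.normSq x.1 = (M : ℤ) ∧ Quaternion.normSq x.2 = (M : ℤ)}

/-- `Twin M` is the number of (ordered) twin pairs of norm `M`. -/
noncomputable def Twin (M : ℕ) : ℕ :=
  (twinPairs M).ncard

/-- The local factor `g (p ^ e)`, for a prime `p ≡ 1 (mod 4)` and `e > 0`. -/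
def twinG (p e : ℕ) : ℕ :=
  if Even e then
    ArithmeticFunction.sigma 1 (p ^ (e / 2)) + ArithmeticFunction.sigma 1 (p ^ (e / 2 - 1))
  else
    2 * ArithmeticFunction.sigma 1 (p ^ (e / 2))

/-- The local factor `h (q ^ e)`, for a prime `q ≡ 3 (mod 4)` and `e > 0`. -/
def twinH (q e : ℕ) : ℕ :=
  if Even e then
    ArithmeticFunction.sigma 1 (q ^ (e / 2)) + ArithmeticFunction.sigma 1 (q ^ (e / 2 - 1))
  else
    0

/-- There is no twin pair of norm `0`, since twins are nonzero. -/
theorem twin_zero : Twin 0 = 0 := by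
  have h : twinPairs 0 = ∅ := by
    ext x
    simp only [twinPairs, Set.mem_ofPred_eq, Set.mem_empty_iff_false, iff_false]
    rintro ⟨hx, h0, -⟩
    refine hx.left_ne_zero ?_
    rw [Quaternion.normSq_def'] at h0
    ext <;> simp <;> push_cast at h0 <;> nlinarith [sq_nonneg x.1.re, sq_nonneg x.1.imI,
      sq_nonneg x.1.imJ, sq_nonneg x.1.imK]
  rw [Twin, h, Set.ncard_empty]

/-- The arithmetic function `M ↦ Twin M / 24`, with exact (rational) division. -/
noncomputable def twinDiv24 : ArithmeticFunction ℚ where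
  toFun M := (Twin M : ℚ) / 24
  map_zero' := by simp [twin_zero]

/-!
The vector `θ + i * η` of a twin pair is a nonzero isotropic vector `(x, y, z)` over the Gaussian
integers, `x ^ 2 + y ^ 2 + z ^ 2 = 0`, and conversely (`twinPairs_equiv`). Put `A = x + i * y` and
`B = x - i * y`, so that `A * B = -z ^ 2`. By unique factorization,
`A = c * u ^ 2`, `B = c * v ^ 2`, `i * z = c * u * v` with `u`, `v` coprime, and the parameters
`(c, u, v)` are determined up to the four units (`exists_param`, `exists_unit_of_param_eq`). In terms
of the parameters the norm of the pair is given by `4 * M = N c * (N u + N v) ^ 2`, and the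
integrality condition `2 ∣ A - B` says that either `N u + N v = n` is odd and `2 ∣ c`, or `u` and `v`
both have odd norm and `N u + N v = 2 * n` with `n` odd; in both cases `M = N c' * n ^ 2`, where `c'`
is `c / 2` or `c` (`paramNorm_sum`). Therefore `Twin M` is a Dirichlet convolution of the number of
Gaussian integers of norm `m` with the function counting the coprime pairs `(u, v)`, placed on the
squares.

The first count is `4 * ∑ d ∣ m, χ d` with `χ` the character modulo `4` (`normCount_eq`). For the
second one, Dirichlet's involution gives `16 * σ n` pairs `(u, v)` of Gaussian integers of odd norm
with `N u + N v = 2 * n`, for odd `n` (`sum_chiSum_eq_sigma`, `card_oddPair`). Sorting these pairs by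
their common factor and inverting the resulting Dirichlet convolution leaves `16 * f n` coprime pairs,
where `f = id * χ μ` on odd numbers (`levelCount_coprimeOdd`); the substitution
`(u, v) ↦ (u + v, u - v)`, up to multiplying the second entry by `i`, gives `8 * f n` coprime pairs
with `N u + N v = n` (`levelCount_coprimeMixed`). Together, `Twin M = 24 * T M` where `T` is the
convolution of `ζ * χ` with `n ^ 2 ↦ f n` (`twin_finite_and_eq`). Hence `T` is multiplicative, its
values at prime powers are the stated local factors, and `T M ≠ 0` makes `M` a norm of a Gaussian
integer times a square, thus a sum of two squares.
-/

/-! ### Counting the levels of a weight function -/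

/-- `levelCount f n` is the number of `x` with `f x = n`, for `n ≠ 0`; the value at `0` is `0`, as
for every arithmetic function. -/
noncomputable def levelCount {α : Type*} (f : α → ℕ) : ArithmeticFunction ℤ where
  toFun n := if n = 0 then 0 else (Nat.card {x // f x = n} : ℤ)
  map_zero' := by simp

/-- Every nonzero value of `f` is attained finitely often. -/
def FiniteLevels {α : Type*} (f : α → ℕ) : Prop :=
  ∀ n, n ≠ 0 → Finite {x // f x = n}

theorem levelCount_apply {α : Type*} (f : α → ℕ) {n : ℕ} (hn : n ≠ 0) :
    levelCount f n = (Nat.card {x // f x = n} : ℤ) := by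
  simp [levelCount, hn]

/-- Sorting the pairs with `f x * g y = n` by the divisor `f x` of `n`. -/
def mulLevelEquiv {α β : Type*} (f : α → ℕ) (g : β → ℕ) {n : ℕ} (hn : n ≠ 0) :
    {x : α × β // f x.1 * g x.2 = n} ≃
      Σ p : n.divisorsAntidiagonal, {x // f x = p.1.1} × {y // g y = p.1.2} where
  toFun x := ⟨⟨(f x.1.1, g x.1.2), by simp [x.2, hn]⟩, ⟨x.1.1, rfl⟩, ⟨x.1.2, rfl⟩⟩
  invFun y := ⟨(y.2.1.1, y.2.2.1), by
    rw [y.2.1.2, y.2.2.2]; exact (Nat.mem_divisorsAntidiagonal.mp y.1.2).1⟩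
  left_inv x := rfl
  right_inv := by
    rintro ⟨⟨⟨a, b⟩, h⟩, ⟨x, hx⟩, ⟨y, hy⟩⟩
    dsimp only at hx hy
    subst hx hy
    rfl

theorem finite_mulLevel {α β : Type*} {f : α → ℕ} {g : β → ℕ} (hf : FiniteLevels f)
    (hg : FiniteLevels g) {n : ℕ} (p : n.divisorsAntidiagonal) :
    Finite ({x // f x = p.1.1} × {y // g y = p.1.2}) := by
  have := hf p.1.1 (Nat.ne_zero_of_mem_divisorsAntidiagonal p.2).1
  have := hg p.1.2 (Nat.ne_zero_of_mem_divisorsAntidiagonal p.2).2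
  infer_instance

theorem levelCount_mul {α β : Type*} {f : α → ℕ} {g : β → ℕ} (hf : FiniteLevels f)
    (hg : FiniteLevels g) :
    levelCount (fun x : α × β => f x.1 * g x.2) = levelCount f * levelCount g := by
  ext n
  rcases eq_or_ne n 0 with rfl | hn
  · simp
  rw [levelCount_apply _ hn, ArithmeticFunction.mul_apply]
  have := finite_mulLevel hf hg (n := n)
  rw [Nat.card_congr (mulLevelEquiv f g hn), Nat.card_sigma]
  push_cast [Nat.card_prod]
  rw [Finset.sum_coe_sort n.divisorsAntidiagonal
    (fun p => ((Nat.card {x // f x = p.1} : ℤ) * (Nat.card {y // g y = p.2} : ℤ)))]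
  refine Finset.sum_congr rfl fun p hp => ?_
  have h := Nat.ne_zero_of_mem_divisorsAntidiagonal hp
  rw [levelCount_apply _ h.1, levelCount_apply _ h.2]

theorem finiteLevels_mul {α β : Type*} {f : α → ℕ} {g : β → ℕ} (hf : FiniteLevels f)
    (hg : FiniteLevels g) : FiniteLevels (fun x : α × β => f x.1 * g x.2) := by
  intro n hn
  have := finite_mulLevel hf hg (n := n)
  exact Finite.of_equiv _ (mulLevelEquiv f g hn).symm

/-- If all fibres of `π` have `k` elements, then the source has `k` times as many elements as the
target. -/
theorem card_eq_mul_of_fiber {α β : Type*} [Finite α] (π : α → β) {k : ℕ} (hk : k ≠ 0)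
    (h : ∀ y, Nat.card {x // π x = y} = k) : Finite β ∧ Nat.card α = k * Nat.card β := by
  have hs : Function.Surjective π := by
    intro y
    have : Nat.card {x // π x = y} ≠ 0 := by rw [h]; exact hk
    obtain ⟨⟨x, hx⟩⟩ := (Nat.card_ne_zero.mp this).1
    exact ⟨x, hx⟩
  have hfin : Finite β := Finite.of_surjective π hs
  refine ⟨hfin, ?_⟩
  have := Fintype.ofFinite β
  rw [← Nat.card_congr (Equiv.sigmaFiberEquiv π), Nat.card_sigma]
  simp [h, mul_comm]

/-- A fibre on which `G` acts simply transitively has as many elements as `G`; `act` is the orbit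
map of a base point `x₀` of the fibre. -/
theorem card_fiber_of_simply_transitive {G α β : Type*} (π : α → β) (y : β)
    (x₀ : α) (hx₀ : π x₀ = y) (act : G → α) (h1 : ∀ g, π (act g) = y)
    (h2 : Function.Injective act) (h3 : ∀ x, π x = π x₀ → ∃ g, act g = x) :
    Nat.card {x // π x = y} = Nat.card G := by
  refine (Nat.card_eq_of_bijective (fun g => (⟨act g, h1 g⟩ : {x // π x = y})) ⟨?_, ?_⟩).symm
  · intro a b h
    exact h2 (by simpa using h)
  · rintro ⟨x, hx⟩
    obtain ⟨g, hg⟩ := h3 x (hx.trans hx₀.symm)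
    exact ⟨g, by simp [hg]⟩

/-! ### Gaussian integers -/

/-- The norm of a Gaussian integer, as a natural number. -/
def gnorm (z : GaussianInt) : ℕ := z.norm.natAbs

theorem gnorm_cast (z : GaussianInt) : (gnorm z : ℤ) = z.norm := GaussianInt.abs_natCast_norm z

theorem gnorm_cast' (z : GaussianInt) : (gnorm z : ℤ) = z.re ^ 2 + z.im ^ 2 := by
  rw [gnorm_cast, Zsqrtd.norm_def]; ring

@[simp] theorem gnorm_mul (z w : GaussianInt) : gnorm (z * w) = gnorm z * gnorm w := by
  simp [gnorm, Zsqrtd.norm_mul, Int.natAbs_mul]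

@[simp] theorem gnorm_eq_zero {z : GaussianInt} : gnorm z = 0 ↔ z = 0 := by
  simp [gnorm, GaussianInt.norm_eq_zero]

@[simp] theorem gnorm_zero : gnorm 0 = 0 := by simp

@[simp] theorem gnorm_star (z : GaussianInt) : gnorm (star z) = gnorm z := by
  simp [gnorm, Zsqrtd.norm_conj]

@[simp] theorem gnorm_unit (e : GaussianIntˣ) : gnorm e = 1 := Zsqrtd.norm_eq_one_iff.mpr e.isUnit

theorem finite_gnorm_le (n : ℕ) : {z : GaussianInt | gnorm z ≤ n}.Finite := by
  refine Set.Finite.subset (((Set.finite_Icc (-(n : ℤ)) n).prod (Set.finite_Icc (-(n : ℤ)) n)).image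
    (fun p => (⟨p.1, p.2⟩ : GaussianInt))) ?_
  intro z hz
  have h : (gnorm z : ℤ) ≤ n := by exact_mod_cast hz
  rw [gnorm_cast'] at h
  refine ⟨(z.re, z.im), ?_, rfl⟩
  simp only [Set.mem_prod, Set.mem_Icc]
  refine ⟨⟨?_, ?_⟩, ?_, ?_⟩ <;> nlinarith [sq_nonneg z.re, sq_nonneg z.im, sq_nonneg (z.re + 1),
    sq_nonneg (z.re - 1), sq_nonneg (z.im + 1), sq_nonneg (z.im - 1)]

theorem finite_gnorm_eq (n : ℕ) : {z : GaussianInt | gnorm z = n}.Finite :=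
  (finite_gnorm_le n).subset fun z (hz : gnorm z = n) => hz.le

theorem finiteLevels_gnorm : FiniteLevels gnorm := fun n _ => (finite_gnorm_eq n).to_subtype

/-- The imaginary unit. -/
def gI : GaussianInt := ⟨0, 1⟩

theorem gI_mul_gI : gI * gI = -1 := by ext <;> simp [gI]

@[simp] theorem gnorm_gI : gnorm gI = 1 := rfl

theorem setOf_gnorm_eq_one :
    {z : GaussianInt | gnorm z = 1} = {1, -1, gI, -gI} := by
  ext z
  simp only [Set.mem_ofPred_eq, Set.mem_insert_iff, Set.mem_singleton_iff]
  constructor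
  · intro h
    have h : (gnorm z : ℤ) = 1 := by exact_mod_cast h
    rw [gnorm_cast'] at h
    have h1 : z.re ≤ 1 := by nlinarith [sq_nonneg z.im]
    have h2 : -1 ≤ z.re := by nlinarith [sq_nonneg z.im]
    have h3 : z.im ≤ 1 := by nlinarith [sq_nonneg z.re]
    have h4 : -1 ≤ z.im := by nlinarith [sq_nonneg z.re]
    obtain ⟨a, b⟩ := z
    simp only at h h1 h2 h3 h4
    interval_cases a <;> interval_cases b <;> simp_all [gI, Zsqrtd.ext_iff]
  · rintro (rfl | rfl | rfl | rfl) <;> rfl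

theorem ncard_gnorm_eq_one : {z : GaussianInt | gnorm z = 1}.ncard = 4 := by
  rw [setOf_gnorm_eq_one]
  have : ({1, -1, gI, -gI} : Set GaussianInt) =
      (({1, -1, gI, -gI} : Finset GaussianInt) : Set _) := by
    simp
  rw [this, Set.ncard_coe_finset]
  rfl

theorem card_gaussianInt_units : Nat.card GaussianIntˣ = 4 := by
  rw [← ncard_gnorm_eq_one, ← Nat.card_coe_set_eq]
  refine Nat.card_eq_of_bijective (fun e => ⟨(e : GaussianInt), gnorm_unit e⟩) ⟨?_, ?_⟩
  · intro a b h
    exact Units.ext (by simpa using h)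
  · rintro ⟨z, hz⟩
    obtain ⟨e, he⟩ := Zsqrtd.norm_eq_one_iff.mp hz
    exact ⟨e, by simp [he]⟩

/-! ### The number of Gaussian integers of given norm -/

/-- The nontrivial Dirichlet character modulo `4`, as an arithmetic function. -/
def chiFour : ArithmeticFunction ℤ where
  toFun n := ZMod.χ₄ n
  map_zero' := by simp

theorem chiFour_apply (n : ℕ) : chiFour n = ZMod.χ₄ n := rfl

theorem chiFour_mul (m n : ℕ) : chiFour (m * n) = chiFour m * chiFour n := by
  rw [chiFour_apply, Nat.cast_mul, map_mul]; rfl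

theorem chiFour_one : chiFour 1 = 1 := by simp [chiFour_apply]

theorem isMultiplicative_chiFour : chiFour.IsMultiplicative :=
  ⟨chiFour_one, fun _ => chiFour_mul _ _⟩

/-- The divisor sum of the character modulo `4`. -/
noncomputable def chiSum : ArithmeticFunction ℤ :=
  (ArithmeticFunction.zeta : ArithmeticFunction ℤ) * chiFour

theorem chiSum_apply (n : ℕ) : chiSum n = ∑ d ∈ n.divisors, chiFour d :=
  ArithmeticFunction.coe_zeta_mul_apply

theorem divisors_prime_mul {p m : ℕ} (hp : p.Prime) (hm : m ≠ 0) :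
    (p * m).divisors = m.divisors ∪ m.divisors.image (p * ·) := by
  have hpm : p * m ≠ 0 := mul_ne_zero hp.ne_zero hm
  ext d
  simp only [Nat.mem_divisors, Finset.mem_union, Finset.mem_image]
  constructor
  · rintro ⟨h, -⟩
    by_cases hd : p ∣ d
    · obtain ⟨e, rfl⟩ := hd
      exact Or.inr ⟨e, ⟨Nat.dvd_of_mul_dvd_mul_left hp.pos h, hm⟩, rfl⟩
    · have hcop := ((Nat.Prime.coprime_iff_not_dvd hp).mpr hd).symm
      exact Or.inl ⟨hcop.dvd_of_dvd_mul_left h, hm⟩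
  · rintro (⟨h, -⟩ | ⟨e, ⟨h, -⟩, rfl⟩)
    · exact ⟨h.mul_left p, hpm⟩
    · exact ⟨Nat.mul_dvd_mul_left p h, hpm⟩

theorem divisors_inter_image {p m : ℕ} (hp : p.Prime) (hm : m ≠ 0) :
    m.divisors ∩ m.divisors.image (p * ·) =
      if p ∣ m then (m / p).divisors.image (p * ·) else ∅ := by
  split_ifs with h
  · obtain ⟨k, rfl⟩ := h
    have hk : k ≠ 0 := right_ne_zero_of_mul hm
    rw [Nat.mul_div_cancel_left _ hp.pos]
    ext d
    simp only [Nat.mem_divisors, Finset.mem_inter, Finset.mem_image]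
    constructor
    · rintro ⟨⟨h1, -⟩, ⟨e, ⟨-, -⟩, rfl⟩⟩
      exact ⟨e, ⟨Nat.dvd_of_mul_dvd_mul_left hp.pos h1, hk⟩, rfl⟩
    · rintro ⟨e, ⟨h, -⟩, rfl⟩
      exact ⟨⟨Nat.mul_dvd_mul_left p h, hm⟩, ⟨e, ⟨h.mul_left p, hm⟩, rfl⟩⟩
  · ext d
    simp only [Nat.mem_divisors, Finset.mem_inter, Finset.mem_image, Finset.notMem_empty, iff_false]
    rintro ⟨⟨h1, -⟩, ⟨e, ⟨-, -⟩, rfl⟩⟩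
    exact h (dvd_of_mul_right_dvd h1)

theorem sum_image_prime_mul {p : ℕ} (hp : p.Prime) (k : ℕ) :
    ∑ d ∈ k.divisors.image (p * ·), chiFour d = chiFour p * chiSum k := by
  rw [Finset.sum_image fun a _ b _ h => Nat.eq_of_mul_eq_mul_left hp.pos h, chiSum_apply,
    Finset.mul_sum]
  simp [chiFour_mul]

/-- Inclusion and exclusion: a divisor of `p * m` divides `m` or is `p` times a divisor of `m`. -/
theorem chiSum_prime_mul {p m : ℕ} (hp : p.Prime) (hm : m ≠ 0) :
    chiSum (p * m) + (if p ∣ m then chiFour p * chiSum (m / p) else 0) =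
      (1 + chiFour p) * chiSum m := by
  have := Finset.sum_union_inter (s₁ := m.divisors) (s₂ := m.divisors.image (p * ·))
    (f := fun d => chiFour d)
  rw [← divisors_prime_mul hp hm, divisors_inter_image hp hm, sum_image_prime_mul hp,
    ← chiSum_apply, ← chiSum_apply] at this
  split_ifs at this ⊢
  · rw [sum_image_prime_mul hp] at this
    linarith
  · rw [Finset.sum_empty] at this
    linarith

/-- The number of Gaussian integers of norm `n`, positive and negative signs and all associates
counted separately. -/
noncomputable def normCount (n : ℕ) : ℕ := {z : GaussianInt | gnorm z = n}.ncard

theorem ncard_image_mul {w : GaussianInt} (hw : w ≠ 0) (n : ℕ) :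
    ((w * ·) '' {z : GaussianInt | gnorm z = n}).ncard = normCount n :=
  Set.ncard_image_of_injective _ (mul_right_injective₀ hw)

theorem prime_of_gnorm_prime {w : GaussianInt} (h : (gnorm w).Prime) : Prime w := by
  refine Irreducible.prime ⟨fun hu => ?_, fun a b hab => ?_⟩
  · rw [← Zsqrtd.norm_eq_one_iff] at hu
    exact h.one_lt.ne' hu
  · subst hab
    rw [gnorm_mul] at h
    rcases Nat.prime_mul_iff.mp h with ⟨-, h⟩ | ⟨-, h⟩
    · exact Or.inr (Zsqrtd.norm_eq_one_iff.mp h)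
    · exact Or.inl (Zsqrtd.norm_eq_one_iff.mp h)

theorem gnorm_eq_mul_star (z : GaussianInt) : ((gnorm z : ℕ) : GaussianInt) = z * star z := by
  rw [← Zsqrtd.norm_eq_mul_conj, ← gnorm_cast]; simp

theorem dvd_or_star_dvd {w z : GaussianInt} (hw : Prime w) (h : w ∣ (gnorm z : GaussianInt)) :
    w ∣ z ∨ star w ∣ z := by
  rw [gnorm_eq_mul_star] at h
  refine (hw.dvd_or_dvd h).imp id fun ⟨t, ht⟩ => ⟨star t, ?_⟩
  rw [← star_mul', ← ht, star_star]

theorem not_dvd_star {w : GaussianInt} {p : ℕ} (hp : p.Prime) (h2 : p ≠ 2) (hw : gnorm w = p) :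
    ¬ w ∣ star w := by
  rintro ⟨t, ht⟩
  -- `w` divides `w + star w = 2 re w`, so `p` divides `4 (re w) ^ 2`, hence `re w` and `im w`
  have h1 : w * (1 + t) = ((2 * w.re : ℤ) : GaussianInt) := by
    rw [mul_add, ← ht]; ext <;> simp; ring
  have h3 : (p : ℤ) ∣ (2 * w.re) ^ 2 := by
    have := congrArg gnorm h1
    rw [gnorm_mul, hw] at this
    refine ⟨gnorm (1 + t), ?_⟩
    have h4 : ((p * gnorm (1 + t) : ℕ) : ℤ) = _ := congrArg Nat.cast this
    rw [gnorm_cast'] at h4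
    push_cast at h4
    simpa using h4.symm
  have hpZ : Prime (p : ℤ) := Nat.prime_iff_prime_int.mp hp
  have h5 : (p : ℤ) ∣ w.re := by
    refine (hpZ.dvd_or_dvd (hpZ.dvd_of_dvd_pow h3)).resolve_left fun h => h2 ?_
    exact (Nat.prime_dvd_prime_iff_eq hp Nat.prime_two).mp (by exact_mod_cast h)
  have h6 : (p : ℤ) = w.re ^ 2 + w.im ^ 2 := by rw [← gnorm_cast', hw]
  have h7 : (p : ℤ) ∣ w.im := by
    refine hpZ.dvd_of_dvd_pow (n := 2) ?_
    rw [show w.im ^ 2 = (p : ℤ) - w.re ^ 2 by linarith]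
    exact dvd_sub dvd_rfl (dvd_pow h5 two_ne_zero)
  obtain ⟨a, ha⟩ := h5
  obtain ⟨b, hb⟩ := h7
  rw [ha, hb] at h6
  have h8 : (1 : ℤ) = p * (a ^ 2 + b ^ 2) :=
    mul_left_cancel₀ (a := (p : ℤ)) (by exact_mod_cast hp.ne_zero) (by linarith)
  exact hpZ.not_isUnit (IsUnit.of_mul_eq_one _ h8.symm)

/-- The recursion for a prime `p = w * star w`: a Gaussian integer of norm `p * m` is divisible by
`w` or by `star w`, and by both exactly when it is divisible by `p`. -/
theorem normCount_split {p m : ℕ} (hp : p.Prime) (h4 : p % 4 = 1) :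
    normCount (p * m) + (if p ∣ m then normCount (m / p) else 0) = 2 * normCount m := by
  have := Fact.mk hp
  obtain ⟨a, b, hab⟩ := Nat.Prime.sq_add_sq (p := p) (by omega)
  obtain ⟨w, hw⟩ : ∃ w, gnorm w = p := ⟨⟨a, b⟩, by
    zify; rw [gnorm_cast']; dsimp only; exact_mod_cast hab⟩
  have hprime : Prime w := prime_of_gnorm_prime (hw ▸ hp)
  have hprime' : Prime (star w) := prime_of_gnorm_prime (by rwa [gnorm_star, hw])
  have hpw : (p : GaussianInt) = w * star w := by rw [← hw, gnorm_eq_mul_star]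
  have hu : {z : GaussianInt | gnorm z = p * m} =
      ((w * ·) '' {z | gnorm z = m}) ∪ ((star w * ·) '' {z | gnorm z = m}) := by
    ext z
    simp only [Set.mem_ofPred_eq, Set.mem_union, Set.mem_image]
    constructor
    · intro h
      have hd : w ∣ (gnorm z : GaussianInt) := by
        rw [h, Nat.cast_mul, hpw, mul_assoc]; exact dvd_mul_right _ _
      refine (dvd_or_star_dvd hprime hd).imp ?_ ?_ <;> rintro ⟨t, rfl⟩ <;> refine ⟨t, ?_, rfl⟩ <;>
        simp only [gnorm_mul, gnorm_star, hw] at h <;> exact Nat.eq_of_mul_eq_mul_left hp.pos h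
    · rintro (⟨t, ht, rfl⟩ | ⟨t, ht, rfl⟩) <;> simp [hw, ht]
  have hi : ((w * ·) '' {z | gnorm z = m}) ∩ ((star w * ·) '' {z | gnorm z = m}) =
      if p ∣ m then (((p : GaussianInt) * ·) '' {z | gnorm z = m / p}) else ∅ := by
    have key : ∀ s t : GaussianInt, w * s = star w * t → gnorm s = m →
        ∃ y, s = star w * y ∧ m = p * gnorm y := by
      intro s t h hs
      have hd : star w ∣ w * s := ⟨t, h⟩
      rcases hprime'.dvd_or_dvd hd with h' | ⟨y, rfl⟩
      · exact absurd (show star w ∣ star (star w) by rw [star_star]; exact h')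
          (not_dvd_star hp (by rintro rfl; omega) (by rw [gnorm_star, hw]))
      · exact ⟨y, rfl, by rw [← hs, gnorm_mul, gnorm_star, hw]⟩
    split_ifs with h
    · obtain ⟨k, rfl⟩ := h
      rw [Nat.mul_div_cancel_left _ hp.pos]
      ext z
      simp only [Set.mem_inter_iff, Set.mem_image, Set.mem_ofPred_eq]
      constructor
      · rintro ⟨⟨s, hs, rfl⟩, ⟨t, ht, h⟩⟩
        obtain ⟨y, rfl, hy⟩ := key s t h.symm hs
        exact ⟨y, (Nat.eq_of_mul_eq_mul_left hp.pos hy).symm, by rw [hpw]; ring⟩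
      · rintro ⟨y, hy, rfl⟩
        exact ⟨⟨star w * y, by simp [hw, hy], by rw [hpw]; ring⟩,
          ⟨w * y, by simp [hw, hy], by rw [hpw]; ring⟩⟩
    · refine Set.eq_empty_of_forall_notMem ?_
      rintro z ⟨⟨s, hs, rfl⟩, ⟨t, ht, h'⟩⟩
      obtain ⟨y, -, hy⟩ := key s t h'.symm hs
      exact h ⟨_, hy⟩
  have hcard := Set.ncard_union_add_ncard_inter ((w * ·) '' {z : GaussianInt | gnorm z = m})
    ((star w * ·) '' {z | gnorm z = m}) ((finite_gnorm_eq m).image _) ((finite_gnorm_eq m).image _)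
  rw [← hu, hi, ncard_image_mul hprime.ne_zero, ncard_image_mul hprime'.ne_zero] at hcard
  rw [two_mul, ← hcard]
  congr 1
  split_ifs
  · rw [ncard_image_mul (by exact_mod_cast hp.ne_zero)]
  · simp

theorem normCount_inert {p m : ℕ} (hp : p.Prime) (h4 : p % 4 = 3) :
    normCount (p * m) = if p ∣ m then normCount (m / p) else 0 := by
  have := Fact.mk hp
  have hprime := GaussianInt.prime_of_nat_prime_of_mod_four_eq_three p h4
  have hnp : gnorm (p : GaussianInt) = p * p := by simp [gnorm, Zsqrtd.norm_def, Int.natAbs_mul]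
  have key : ∀ z : GaussianInt, gnorm z = p * m → ∃ y, z = p * y ∧ m = p * gnorm y := by
    intro z h
    have hd : (p : GaussianInt) ∣ (gnorm z : GaussianInt) := by
      rw [h, Nat.cast_mul]; exact dvd_mul_right _ _
    have hs : star (p : GaussianInt) = p := by ext <;> simp
    have hd' := dvd_or_star_dvd hprime hd
    rw [hs, or_self] at hd'
    obtain ⟨y, rfl⟩ := hd'
    refine ⟨y, rfl, ?_⟩
    rw [gnorm_mul, hnp, mul_assoc] at h
    exact (Nat.eq_of_mul_eq_mul_left hp.pos h).symm
  split_ifs with h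
  · obtain ⟨k, rfl⟩ := h
    rw [Nat.mul_div_cancel_left _ hp.pos]
    refine Eq.trans ?_ (ncard_image_mul (w := (p : GaussianInt)) (by exact_mod_cast hp.ne_zero) k)
    rw [normCount]
    congr 1
    ext z
    simp only [Set.mem_ofPred_eq, Set.mem_image]
    constructor
    · intro h
      obtain ⟨y, rfl, hy⟩ := key z h
      exact ⟨y, (Nat.eq_of_mul_eq_mul_left hp.pos hy).symm, rfl⟩
    · rintro ⟨y, hy, rfl⟩
      rw [gnorm_mul, hnp, hy, mul_assoc]
  · rw [normCount, Set.eq_empty_of_forall_notMem (s := {z : GaussianInt | gnorm z = p * m}),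
      Set.ncard_empty]
    intro z hz
    obtain ⟨y, -, hy⟩ := key z hz
    exact h ⟨_, hy⟩

/-- The prime element above `2`. -/
def gTwo : GaussianInt := ⟨1, 1⟩

@[simp] theorem gnorm_gTwo : gnorm gTwo = 2 := rfl

theorem gTwo_ne_zero : gTwo ≠ 0 := by
  intro h; simpa using congrArg gnorm h

theorem gTwo_dvd_iff {z : GaussianInt} : gTwo ∣ z ↔ Even (gnorm z) := by
  constructor
  · rintro ⟨t, rfl⟩
    simp
  · intro h
    have h : Even ((gnorm z : ℕ) : ℤ) := by exact_mod_cast h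
    rw [gnorm_cast'] at h
    have h' : Even (z.re + z.im) := by simpa [Int.even_add, Int.even_pow] using h
    obtain ⟨k, hk⟩ := h'
    refine ⟨⟨k, k - z.re⟩, ?_⟩
    ext <;> simp [gTwo]
    linarith

theorem normCount_two_mul (m : ℕ) : normCount (2 * m) = normCount m := by
  rw [← ncard_image_mul gTwo_ne_zero m, normCount]
  congr 1
  ext z
  simp only [Set.mem_ofPred_eq, Set.mem_image]
  constructor
  · intro h
    obtain ⟨t, rfl⟩ := gTwo_dvd_iff.mpr (h ▸ even_two_mul m)
    exact ⟨t, by simpa using h, rfl⟩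
  · rintro ⟨t, ht, rfl⟩
    simp [ht]

/-- Jacobi's two-square theorem. Both sides satisfy the same recursion
`r (p * m) = (1 + χ p) * r m - χ p * r (m / p)`, according to the splitting of the prime `p` in the
Gaussian integers. -/
theorem normCount_eq (n : ℕ) (hn : n ≠ 0) : (normCount n : ℤ) = 4 * chiSum n := by
  induction n using Nat.strong_induction_on with
  | _ n ih =>
    by_cases h1 : n = 1
    · subst h1
      rw [normCount, ncard_gnorm_eq_one, chiSum_apply]
      simp [chiFour_one]
    have hp := Nat.minFac_prime h1
    obtain ⟨m, hm⟩ := Nat.minFac_dvd n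
    set p := n.minFac
    have hm0 : m ≠ 0 := by rintro rfl; exact hn (by simpa using hm)
    have hlt : m < n := by
      rw [hm]; exact lt_mul_of_one_lt_left (Nat.pos_of_ne_zero hm0) hp.one_lt
    have hrec := chiSum_prime_mul hp hm0
    have ihm := ih m hlt hm0
    have ihd : p ∣ m → (normCount (m / p) : ℤ) = 4 * chiSum (m / p) := by
      rintro ⟨k, hk⟩
      rw [hk, Nat.mul_div_cancel_left _ hp.pos]
      have hk0 : k ≠ 0 := by rintro rfl; exact hm0 (by simpa using hk)
      refine ih k (lt_of_le_of_lt ?_ hlt) hk0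
      rw [hk]; exact Nat.le_mul_of_pos_left k hp.pos
    rw [hm]
    rcases hp.eq_two_or_odd with h2 | hodd
    · have hc : chiFour p = 0 := by rw [h2]; rfl
      rw [hc] at hrec
      simp only [zero_mul, ite_self, add_zero, one_mul] at hrec
      rw [hrec, ← ihm, h2, normCount_two_mul]
    have h4 : p % 4 = 1 ∨ p % 4 = 3 := by omega
    rcases h4 with h4 | h4
    · have hc : chiFour p = 1 := ZMod.χ₄_nat_one_mod_four h4
      rw [hc] at hrec
      have hs : ((normCount (p * m) + (if p ∣ m then normCount (m / p) else 0) : ℕ) : ℤ) = _ :=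
        congrArg Nat.cast (normCount_split (m := m) hp h4)
      split_ifs at hs hrec with hd
      · push_cast at hs
        rw [ihm, ihd hd] at hs
        linarith
      · push_cast at hs
        rw [ihm] at hs
        linarith
    · have hc : chiFour p = -1 := ZMod.χ₄_nat_three_mod_four h4
      rw [hc] at hrec
      rw [normCount_inert hp h4]
      split_ifs at hrec ⊢ with hd
      · rw [ihd hd]; linarith
      · push_cast; linarith

theorem levelCount_gnorm : levelCount gnorm = 4 * chiSum := by
  ext n
  rcases eq_or_ne n 0 with rfl | hn
  · simp
  rw [levelCount_apply _ hn]
  have : (4 * chiSum) n = 4 * chiSum n := by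
    rw [show (4 : ArithmeticFunction ℤ) * chiSum = chiSum + chiSum + chiSum + chiSum by ring]
    simp only [ArithmeticFunction.add_apply]; ring
  rw [this, ← normCount_eq n hn]
  rfl

/-! ### Representations of `4 * n` by four odd squares -/

/-- The quadruples `((d, x), (e, y))` of odd numbers with `d * x + e * y = 2 * n`. -/
def oddQuads (n : ℕ) : Finset ((ℕ × ℕ) × (ℕ × ℕ)) :=
  ((Finset.HasAntidiagonal.antidiagonal (2 * n)).filter fun p => Odd p.1).biUnion fun p =>
    p.1.divisorsAntidiagonal ×ˢ p.2.divisorsAntidiagonal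

theorem mem_oddQuads {n : ℕ} {d x e y : ℕ} :
    ((d, x), (e, y)) ∈ oddQuads n ↔
      d * x + e * y = 2 * n ∧ Odd d ∧ Odd x ∧ Odd e ∧ Odd y := by
  simp only [oddQuads, Finset.mem_biUnion, Finset.mem_filter,
    Finset.HasAntidiagonal.mem_antidiagonal, Finset.mem_product, Nat.mem_divisorsAntidiagonal,
    Prod.exists]
  constructor
  · rintro ⟨a, b, ⟨h, ha⟩, ⟨rfl, -⟩, rfl, -⟩
    have h2 : Odd (e * y) := by
      by_contra hc
      rw [Nat.not_odd_iff_even] at hc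
      have := ha.add_even hc
      rw [h] at this
      exact absurd (even_two_mul n) (Nat.not_even_iff_odd.mpr this)
    rw [Nat.odd_mul] at ha h2
    exact ⟨h, ha.1, ha.2, h2.1, h2.2⟩
  · rintro ⟨h, hd, hx, he, hy⟩
    exact ⟨d * x, e * y, ⟨h, hd.mul hx⟩, ⟨rfl, (hd.mul hx).pos.ne'⟩, rfl, (he.mul hy).pos.ne'⟩

theorem chiSum_apply' (n : ℕ) : chiSum n = ∑ p ∈ n.divisorsAntidiagonal, chiFour p.1 := by
  rw [chiSum_apply, Nat.sum_divisorsAntidiagonal (f := fun d _ => chiFour d)]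

theorem sum_chiSum_mul_chiSum (n : ℕ) :
    ∑ p ∈ (Finset.HasAntidiagonal.antidiagonal (2 * n)).filter (fun p => Odd p.1),
        chiSum p.1 * chiSum p.2 =
      ∑ q ∈ oddQuads n, chiFour q.1.1 * chiFour q.2.1 := by
  rw [oddQuads, Finset.sum_biUnion]
  · refine Finset.sum_congr rfl fun p _ => ?_
    rw [chiSum_apply', chiSum_apply', Finset.sum_mul_sum, Finset.sum_product]
  · intro p _ p' _ hne
    rw [Function.onFun, Finset.disjoint_left]
    rintro q hq hq'
    simp only [Finset.mem_product, Nat.mem_divisorsAntidiagonal] at hq hq'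
    exact hne (Prod.ext (hq.1.1.symm.trans hq'.1.1) (hq.2.1.symm.trans hq'.2.1))

theorem chiFour_mul_self {d : ℕ} (hd : Odd d) : chiFour d * chiFour d = 1 := by
  have : d % 4 = 1 ∨ d % 4 = 3 := by have := Nat.odd_iff.mp hd; omega
  rcases this with h | h
  · rw [chiFour_apply, ZMod.χ₄_nat_one_mod_four h]; rfl
  · rw [chiFour_apply, ZMod.χ₄_nat_three_mod_four h]; rfl

theorem chiFour_add_mul {e a : ℕ} (he : Odd e) (ha : Even a) :
    chiFour (a + e) * chiFour e = if a % 4 = 0 then 1 else -1 := by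
  have h1 : e % 4 = 1 ∨ e % 4 = 3 := by have := Nat.odd_iff.mp he; omega
  have h2 : a % 4 = 0 ∨ a % 4 = 2 := by have := Nat.even_iff.mp ha; omega
  simp only [chiFour_apply]
  rcases h1 with h1 | h1 <;> rcases h2 with h2 | h2 <;>
    rw [ZMod.χ₄_nat_mod_four (a + e), ZMod.χ₄_nat_mod_four e, Nat.add_mod, h1, h2] <;> rfl

/-- Dirichlet's involution on the quadruples with `e < d`. In the coordinates `a = d - e`, `b = e`,
`c = x`, `s = x + y`, where the equation reads `a * c + b * s = 2 * n`, it is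
`(a, b, c, s) ↦ (s, c + s * (b / a), b % a, a)`. -/
def quadInvolution (q : (ℕ × ℕ) × (ℕ × ℕ)) : (ℕ × ℕ) × (ℕ × ℕ) :=
  let a := q.1.1 - q.2.1
  let b := q.2.1
  let c := q.1.2
  let s := q.1.2 + q.2.2
  ((s + (c + s * (b / a)), b % a), (c + s * (b / a), a - b % a))

theorem sum_oddQuads_gt {n : ℕ} (hn : Odd n) :
    ∑ q ∈ (oddQuads n).filter (fun q => q.2.1 < q.1.1), chiFour q.1.1 * chiFour q.2.1 = 0 := by
  have main : ∀ q ∈ (oddQuads n).filter (fun q => q.2.1 < q.1.1),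
      ∃ a b c s, q = ((a + b, c), (b, s - c)) ∧ Even a ∧ 0 < a ∧ Odd b ∧ Odd c ∧ Even s ∧ c < s ∧
        a * c + b * s = 2 * n := by
    rintro ⟨⟨d, x⟩, ⟨e, y⟩⟩ hq
    simp only [Finset.mem_filter, mem_oddQuads] at hq
    obtain ⟨⟨h, hd, hx, he, hy⟩, hlt⟩ := hq
    refine ⟨d - e, e, x, x + y, ?_, Nat.Odd.sub_odd hd he, Nat.sub_pos_of_lt hlt, he, hx,
      hx.add_odd hy, Nat.lt_add_of_pos_right hy.pos, ?_⟩
    · rw [Nat.sub_add_cancel hlt.le, Nat.add_sub_cancel_left]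
    · obtain ⟨k, rfl⟩ := Nat.exists_eq_add_of_lt hlt
      rw [← h, show e + k + 1 - e = k + 1 by omega]; ring
  have inv_apply : ∀ a b c s, c < s → quadInvolution ((a + b, c), (b, s - c)) =
      ((s + (c + s * (b / a)), b % a), (c + s * (b / a), a - b % a)) := by
    intro a b c s h
    simp only [quadInvolution, Nat.add_sub_cancel, Nat.add_sub_cancel' h.le]
  have hmod : ∀ a b : ℕ, Even a → Odd b → Odd (b % a) := by
    intro a b ha hb
    have := Nat.mod_add_div b a
    rw [← this] at hb
    exact (Nat.odd_add.mp hb).mpr (ha.mul_right _)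
  have hneg : ∀ q ∈ (oddQuads n).filter (fun q => q.2.1 < q.1.1),
      chiFour q.1.1 * chiFour q.2.1 +
        chiFour (quadInvolution q).1.1 * chiFour (quadInvolution q).2.1 = 0 := by
    intro q hq
    obtain ⟨a, b, c, s, rfl, ha, ha0, hb, hc, hs, hcs, h⟩ := main q hq
    rw [inv_apply _ _ _ _ hcs]
    dsimp only
    rw [chiFour_add_mul hb ha, chiFour_add_mul (hc.add_even (hs.mul_right _)) hs]
    -- `a / 2 + s / 2` is odd, so exactly one of `a` and `s` is divisible by `4`
    obtain ⟨a', rfl⟩ := ha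
    obtain ⟨s', rfl⟩ := hs
    have h' : a' * c + b * s' = n := by nlinarith
    rw [← h', Nat.odd_add, Nat.odd_mul, Nat.even_mul] at hn
    rw [← Nat.not_even_iff_odd] at hb
    rw [Nat.odd_iff, Nat.odd_iff, Nat.even_iff, Nat.even_iff] at hn
    rw [Nat.even_iff] at hb
    rw [Nat.odd_iff] at hc
    split_ifs <;> omega
  refine Finset.sum_involution (fun q _ => quadInvolution q) hneg ?_ ?_ ?_
  · intro q hq hne heq
    have := hneg q hq
    rw [heq] at this
    exact hne (by linarith)
  · intro q hq
    obtain ⟨a, b, c, s, rfl, ha, ha0, hb, hc, hs, hcs, h⟩ := main q hq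
    have hlt := Nat.mod_lt b ha0
    rw [inv_apply _ _ _ _ hcs, Finset.mem_filter, mem_oddQuads]
    refine ⟨⟨?_, ?_, hmod a b ha hb, ?_, ?_⟩, ?_⟩
    · have h1 := Nat.mod_add_div b a
      have h2 : a - b % a + b % a = a := Nat.sub_add_cancel hlt.le
      set t := a - b % a
      set m := b % a
      set k := b / a
      rw [← h, ← h2, ← h1, ← h2]; ring
    · exact hs.add_odd (hc.add_even (hs.mul_right _))
    · exact hc.add_even (hs.mul_right _)
    · exact Nat.Even.sub_odd hlt.le ha (hmod a b ha hb)
    · dsimp only; omega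
  · intro q hq
    obtain ⟨a, b, c, s, rfl, ha, ha0, hb, hc, hs, hcs, h⟩ := main q hq
    have hlt := Nat.mod_lt b ha0
    have hs0 : 0 < s := by omega
    rw [inv_apply _ _ _ _ hcs, inv_apply _ _ _ _ hlt,
      Nat.add_mul_div_left _ _ hs0, Nat.div_eq_of_lt hcs, Nat.add_mul_mod_self_left,
      Nat.mod_eq_of_lt hcs, zero_add, Nat.mod_add_div]

theorem sum_oddQuads_eq {n : ℕ} (hn : Odd n) :
    ∑ q ∈ (oddQuads n).filter (fun q => q.2.1 = q.1.1), chiFour q.1.1 * chiFour q.2.1 =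
      (ArithmeticFunction.sigma 1 n : ℤ) := by
  have h1 : ∑ q ∈ (oddQuads n).filter (fun q => q.2.1 = q.1.1), chiFour q.1.1 * chiFour q.2.1 =
      ∑ q ∈ (oddQuads n).filter (fun q => q.2.1 = q.1.1), (1 : ℤ) := by
    refine Finset.sum_congr rfl ?_
    rintro ⟨⟨d, x⟩, ⟨e, y⟩⟩ hq
    simp only [Finset.mem_filter, mem_oddQuads] at hq
    rw [hq.2, chiFour_mul_self hq.1.2.1]
  rw [h1, ArithmeticFunction.sigma_eq_sum_div]
  simp only [pow_one, Finset.sum_const, nsmul_eq_mul, mul_one]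
  have h2 : ((oddQuads n).filter (fun q => q.2.1 = q.1.1)).card =
      (n.divisors.sigma fun d => Finset.range (n / d)).card := by
    symm
    refine Finset.card_nbij' (fun t => ((t.1, 2 * t.2 + 1), (t.1, 2 * (n / t.1 - t.2) - 1)))
      (fun q => ⟨q.1.1, q.1.2 / 2⟩) ?_ ?_ ?_ ?_
    · rintro ⟨d, j⟩ h
      simp only [Finset.coe_sigma, Set.mem_sigma_iff, Finset.mem_coe, Nat.mem_divisors,
        Finset.mem_range] at h
      obtain ⟨⟨⟨k, rfl⟩, hn0⟩, hj⟩ := h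
      have hd0 : 0 < d := Nat.pos_of_ne_zero (left_ne_zero_of_mul hn0)
      rw [Nat.mul_div_cancel_left _ hd0] at hj
      simp only [Finset.coe_filter, Set.mem_ofPred_eq, mem_oddQuads, and_true,
        Nat.mul_div_cancel_left _ hd0]
      rw [Nat.odd_mul] at hn
      refine ⟨?_, hn.1, odd_two_mul_add_one j, hn.1, ?_⟩
      · rw [← mul_add, show 2 * j + 1 + (2 * (k - j) - 1) = 2 * k by omega]; ring
      · rw [Nat.odd_iff]; omega
    · rintro ⟨⟨d, x⟩, ⟨e, y⟩⟩ hq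
      simp only [Finset.coe_filter, Set.mem_ofPred_eq, mem_oddQuads] at hq
      obtain ⟨⟨h, hd, hx, he, hy⟩, rfl⟩ := hq
      obtain ⟨i, rfl⟩ := hx
      obtain ⟨j, rfl⟩ := hy
      have hnk : n = e * (i + j + 1) := by nlinarith
      simp only [Finset.coe_sigma, Set.mem_sigma_iff, Finset.mem_coe, Nat.mem_divisors,
        Finset.mem_range]
      refine ⟨⟨⟨_, hnk⟩, hn.pos.ne'⟩, ?_⟩
      rw [hnk, Nat.mul_div_cancel_left _ he.pos]
      omega
    · rintro ⟨d, j⟩ h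
      simp only [Sigma.mk.injEq, heq_eq_eq, true_and]
      omega
    · rintro ⟨⟨d, x⟩, ⟨e, y⟩⟩ hq
      simp only [Finset.coe_filter, Set.mem_ofPred_eq, mem_oddQuads] at hq
      obtain ⟨⟨h, hd, hx, he, hy⟩, rfl⟩ := hq
      obtain ⟨i, rfl⟩ := hx
      obtain ⟨j, rfl⟩ := hy
      have hnk : n = e * (i + j + 1) := by nlinarith
      simp only [Prod.mk.injEq, true_and]
      rw [hnk, Nat.mul_div_cancel_left _ he.pos]
      omega
  rw [h2, Finset.card_sigma]
  simp

/-- The number of representations of `2 * n` as a sum of the norms of two Gaussian integers of odd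
norm is `16 * σ n`; here both factors `4` have been removed. Only the quadruples with `d = e`
contribute to the sum over `oddQuads n`. -/
theorem sum_chiSum_eq_sigma {n : ℕ} (hn : Odd n) :
    ∑ p ∈ (Finset.HasAntidiagonal.antidiagonal (2 * n)).filter (fun p => Odd p.1),
        chiSum p.1 * chiSum p.2 =
      (ArithmeticFunction.sigma 1 n : ℤ) := by
  rw [sum_chiSum_mul_chiSum, ← Finset.sum_filter_add_sum_filter_not _ (fun q => q.2.1 = q.1.1),
    sum_oddQuads_eq hn, ← Finset.sum_filter_add_sum_filter_not _ (fun q => q.2.1 < q.1.1),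
    Finset.filter_filter, Finset.filter_filter]
  have hgt : (oddQuads n).filter (fun q => ¬ q.2.1 = q.1.1 ∧ q.2.1 < q.1.1) =
      (oddQuads n).filter (fun q => q.2.1 < q.1.1) :=
    Finset.filter_congr fun q _ => ⟨fun h => h.2, fun h => ⟨h.ne, h⟩⟩
  have hlt : ∑ q ∈ (oddQuads n).filter (fun q => ¬ q.2.1 = q.1.1 ∧ ¬ q.2.1 < q.1.1),
        chiFour q.1.1 * chiFour q.2.1 =
      ∑ q ∈ (oddQuads n).filter (fun q => q.2.1 < q.1.1), chiFour q.1.1 * chiFour q.2.1 := by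
    refine Finset.sum_nbij' Prod.swap Prod.swap ?_ ?_ (fun _ _ => rfl) (fun _ _ => rfl)
      (fun q _ => mul_comm _ _)
    · rintro ⟨⟨d, x⟩, ⟨e, y⟩⟩ hq
      simp only [Finset.mem_filter, mem_oddQuads, Prod.swap] at hq ⊢
      obtain ⟨⟨h, hd, hx, he, hy⟩, h1, h2⟩ := hq
      exact ⟨⟨by rw [add_comm]; exact h, he, hy, hd, hx⟩, by omega⟩
    · rintro ⟨⟨d, x⟩, ⟨e, y⟩⟩ hq
      simp only [Finset.mem_filter, mem_oddQuads, Prod.swap] at hq ⊢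
      obtain ⟨⟨h, hd, hx, he, hy⟩, h1⟩ := hq
      exact ⟨⟨by rw [add_comm]; exact h, he, hy, hd, hx⟩, by omega, by omega⟩
  rw [hgt, hlt, sum_oddQuads_gt hn]
  simp

/-! ### Coprime pairs of Gaussian integers -/

theorem even_gnorm_iff {z : GaussianInt} : Even (gnorm z) ↔ Even (z.re + z.im) := by
  have : Even (gnorm z) ↔ Even ((gnorm z : ℕ) : ℤ) := by simp
  rw [this, gnorm_cast']
  simp [Int.even_add, Int.even_pow]

theorem odd_gnorm_iff {z : GaussianInt} : Odd (gnorm z) ↔ Odd (z.re + z.im) := by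
  rw [← Nat.not_even_iff_odd, even_gnorm_iff, Int.not_even_iff_odd]

theorem odd_gnorm_add {u v : GaussianInt} : Odd (gnorm (u + v)) ↔ Odd (gnorm u + gnorm v) := by
  rw [← Nat.not_even_iff_odd, ← Nat.not_even_iff_odd, Nat.even_add, even_gnorm_iff, even_gnorm_iff,
    even_gnorm_iff, ← Int.even_add]
  have : (u + v).re + (u + v).im = u.re + u.im + (v.re + v.im) := by simp; ring
  rw [this]

theorem odd_gnorm_sub {u v : GaussianInt} : Odd (gnorm (u - v)) ↔ Odd (gnorm u + gnorm v) := by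
  have h : gnorm (-v) = gnorm v := by simp [gnorm]
  rw [sub_eq_add_neg, odd_gnorm_add, h]

theorem gnorm_mod_four {z : GaussianInt} (h : Odd (gnorm z)) : gnorm z % 4 = 1 := by
  have h2 := odd_gnorm_iff.mp h
  zify
  rw [gnorm_cast']
  rcases Int.even_or_odd' z.re with ⟨a, ha | ha⟩ <;> rcases Int.even_or_odd' z.im with ⟨b, hb | hb⟩
  · rw [ha, hb] at h2; obtain ⟨k, hk⟩ := h2; omega
  · rw [ha, hb, show (2 * a) ^ 2 + (2 * b + 1) ^ 2 = 1 + 4 * (a ^ 2 + b ^ 2 + b) by ring]; omega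
  · rw [ha, hb, show (2 * a + 1) ^ 2 + (2 * b) ^ 2 = 1 + 4 * (a ^ 2 + b ^ 2 + a) by ring]; omega
  · rw [ha, hb] at h2; obtain ⟨k, hk⟩ := h2; omega

theorem isCoprime_two {z : GaussianInt} (h : Odd (gnorm z)) : IsCoprime z 2 := by
  obtain ⟨k, hk⟩ := h
  have h1 := gnorm_eq_mul_star z
  rw [hk] at h1
  push_cast at h1
  exact ⟨star z, -k, by linear_combination -h1⟩

/-- Gaussian integers of odd norm. -/
abbrev OddGaussian := {z : GaussianInt // Odd (gnorm z)}

/-- Pairs of Gaussian integers of odd norm. -/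
abbrev OddPair := {p : GaussianInt × GaussianInt // Odd (gnorm p.1) ∧ Odd (gnorm p.2)}

/-- Coprime pairs of Gaussian integers of odd norm. -/
abbrev CoprimeOdd :=
  {p : GaussianInt × GaussianInt // IsCoprime p.1 p.2 ∧ Odd (gnorm p.1) ∧ Odd (gnorm p.2)}

/-- Coprime pairs of Gaussian integers whose norms have opposite parity. -/
abbrev CoprimeMixed :=
  {p : GaussianInt × GaussianInt // IsCoprime p.1 p.2 ∧ Odd (gnorm p.1 + gnorm p.2)}

/-- Half the sum of the norms, an exact division if both norms are odd. -/
def halfNorm (p : GaussianInt × GaussianInt) : ℕ := (gnorm p.1 + gnorm p.2) / 2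

/-- The sum of the norms. -/
def sumNorm (p : GaussianInt × GaussianInt) : ℕ := gnorm p.1 + gnorm p.2

theorem two_mul_halfNorm {p : GaussianInt × GaussianInt} (h : Odd (gnorm p.1))
    (h' : Odd (gnorm p.2)) : 2 * halfNorm p = gnorm p.1 + gnorm p.2 :=
  Nat.mul_div_cancel' (h.add_odd h').two_dvd

theorem odd_halfNorm {p : GaussianInt × GaussianInt} (h : Odd (gnorm p.1))
    (h' : Odd (gnorm p.2)) : Odd (halfNorm p) := by
  have h1 := gnorm_mod_four h
  have h2 := gnorm_mod_four h'
  rw [halfNorm, Nat.odd_iff]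
  omega

theorem finite_sumNorm_le (n : ℕ) : {p : GaussianInt × GaussianInt | sumNorm p ≤ n}.Finite := by
  refine ((finite_gnorm_le n).prod (finite_gnorm_le n)).subset fun p hp => ?_
  have hp : gnorm p.1 + gnorm p.2 ≤ n := hp
  exact ⟨(Nat.le_add_right _ _).trans hp, (Nat.le_add_left _ _).trans hp⟩

theorem finiteLevels_of_sumNorm_le {P : GaussianInt × GaussianInt → Prop}
    (f : {p // P p} → ℕ) (h : ∀ p, sumNorm p.1 ≤ 2 * f p) : FiniteLevels f := by
  intro n _
  have := (finite_sumNorm_le (2 * n)).to_subtype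
  refine Finite.of_injective (β := {p | sumNorm p ≤ 2 * n})
    (fun x => ⟨x.1.1, by have := h x.1; rw [x.2] at this; exact this⟩) ?_
  intro x y hxy
  exact Subtype.ext (Subtype.ext (by simpa using hxy))

theorem finiteLevels_coprimeOdd : FiniteLevels fun p : CoprimeOdd => halfNorm p.1 :=
  finiteLevels_of_sumNorm_le _ fun p => (two_mul_halfNorm p.2.2.1 p.2.2.2).ge

theorem finiteLevels_coprimeMixed : FiniteLevels fun p : CoprimeMixed => sumNorm p.1 :=
  finiteLevels_of_sumNorm_le _ fun _ => Nat.le_mul_of_pos_left _ two_pos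

theorem finiteLevels_oddGaussian : FiniteLevels fun z : OddGaussian => gnorm z.1 := by
  intro n hn
  have := finiteLevels_gnorm n hn
  refine Finite.of_injective (β := {z // gnorm z = n}) (fun x => ⟨x.1.1, x.2⟩) ?_
  intro x y hxy
  exact Subtype.ext (Subtype.ext (by simpa using hxy))

/-- A weight-preserving map with fibres of size `k` divides the level counts by `k`. -/
theorem card_level_of_fiber {α β : Type*} {f : α → ℕ} {g : β → ℕ} (π : α → β)
    (hπ : ∀ x, g (π x) = f x) {k n : ℕ} (hfin : Finite {x // f x = n}) (hk : k ≠ 0)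
    (h : ∀ y, g y = n → Nat.card {x // π x = y} = k) :
    Finite {y // g y = n} ∧ Nat.card {x // f x = n} = k * Nat.card {y // g y = n} := by
  refine card_eq_mul_of_fiber (fun x : {x // f x = n} => (⟨π x.1, by rw [hπ, x.2]⟩ : {y // g y = n}))
    hk ?_
  rintro ⟨y, hy⟩
  rw [← h y hy]
  refine Nat.card_congr
    { toFun := fun x => ⟨x.1.1, congrArg Subtype.val x.2⟩
      invFun := fun x => ⟨⟨x.1, by rw [← hπ, x.2, hy]⟩, Subtype.ext x.2⟩
      left_inv := fun _ => rfl
      right_inv := fun _ => rfl }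

theorem levelCount_of_fiber {α β : Type*} {f : α → ℕ} {g : β → ℕ} (π : α → β)
    (hπ : ∀ x, g (π x) = f x) {k : ℕ} (hfin : FiniteLevels f) (hk : k ≠ 0)
    (h : ∀ y, g y ≠ 0 → Nat.card {x // π x = y} = k) (n : ℕ) :
    levelCount f n = k * levelCount g n := by
  rcases eq_or_ne n 0 with rfl | hn
  · simp
  rw [levelCount_apply _ hn, levelCount_apply _ hn,
    (card_level_of_fiber π hπ (hfin n hn) hk fun y hy => h y (hy ▸ hn)).2]
  push_cast; rfl

theorem exists_coprime_factor {a b : GaussianInt} (h : a ≠ 0 ∨ b ≠ 0) :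
    ∃ g u v, g ≠ 0 ∧ a = g * u ∧ b = g * v ∧ IsCoprime u v := by
  have hg : EuclideanDomain.gcd a b ≠ 0 := by
    rw [Ne, EuclideanDomain.gcd_eq_zero_iff]
    tauto
  obtain ⟨u, hu⟩ := EuclideanDomain.gcd_dvd_left a b
  obtain ⟨v, hv⟩ := EuclideanDomain.gcd_dvd_right a b
  refine ⟨_, u, v, hg, hu, hv, EuclideanDomain.gcdA a b, EuclideanDomain.gcdB a b, ?_⟩
  have h1 := EuclideanDomain.gcd_eq_gcd_ab a b
  refine mul_left_cancel₀ hg ?_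
  nth_rewrite 2 [hu] at h1
  nth_rewrite 4 [hv] at h1
  linear_combination -h1

/-- The factorization of a pair as a common factor times a coprime pair is unique up to a unit. -/
theorem exists_unit_of_mul_eq {g u v g' u' v' : GaussianInt} (hg : g ≠ 0) (hc : IsCoprime u v)
    (hc' : IsCoprime u' v') (h1 : g * u = g' * u') (h2 : g * v = g' * v') :
    ∃ e : GaussianIntˣ, u' = e * u ∧ v' = e * v ∧ g' = (e⁻¹ : GaussianIntˣ) * g := by
  obtain ⟨a, b, hab⟩ := hc
  obtain ⟨a', b', hab'⟩ := hc'
  have h3 : g' * (a * u' + b * v') = g := by linear_combination -a * h1 - b * h2 + g * hab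
  have h4 : g * (a' * u + b' * v) = g' := by linear_combination a' * h1 + b' * h2 + g' * hab'
  have hg' : g' ≠ 0 := by rintro rfl; exact hg (by rw [← h3, zero_mul])
  have h5 : (a * u' + b * v') * (a' * u + b' * v) = 1 := by
    refine mul_left_cancel₀ hg' ?_
    rw [← mul_assoc, h3, h4, mul_one]
  refine ⟨⟨a * u' + b * v', a' * u + b' * v, h5, by rw [mul_comm, h5]⟩, ?_, ?_, ?_⟩
  · refine mul_left_cancel₀ hg' ?_
    rw [Units.val_mk, ← mul_assoc, h3, h1]
  · refine mul_left_cancel₀ hg' ?_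
    rw [Units.val_mk, ← mul_assoc, h3, h2]
  · rw [Units.inv_mk, Units.val_mk, mul_comm, h4]

/-- Multiplication of a coprime pair by a common factor. -/
def scalePair (x : OddGaussian × CoprimeOdd) : OddPair :=
  ⟨(x.1.1 * x.2.1.1, x.1.1 * x.2.1.2), by
    rw [gnorm_mul, gnorm_mul]
    exact ⟨x.1.2.mul x.2.2.2.1, x.1.2.mul x.2.2.2.2⟩⟩

theorem halfNorm_scalePair (x : OddGaussian × CoprimeOdd) :
    halfNorm (scalePair x).1 = gnorm x.1.1 * halfNorm x.2.1 := by
  have h1 := two_mul_halfNorm (scalePair x).2.1 (scalePair x).2.2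
  have h2 := two_mul_halfNorm x.2.2.2.1 x.2.2.2.2
  have h3 : gnorm (scalePair x).1.1 + gnorm (scalePair x).1.2 =
      gnorm x.1.1 * (gnorm x.2.1.1 + gnorm x.2.1.2) := by
    simp only [scalePair, gnorm_mul]; ring
  rw [h3, ← h2] at h1
  exact Nat.eq_of_mul_eq_mul_left two_pos (h1.trans (by ring))

theorem IsCoprime.units_mul {u v : GaussianInt} (h : IsCoprime u v) (e : GaussianIntˣ) :
    IsCoprime (e * u) (e * v) :=
  (isCoprime_mul_unit_left e.isUnit u v).mpr h

theorem card_fiber_scalePair (y : OddPair) : Nat.card {x // scalePair x = y} = 4 := by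
  have hy0 : y.1.1 ≠ 0 := fun h => by have := y.2.1; simp [h] at this
  obtain ⟨g, u, v, hg, hu, hv, hc⟩ := exists_coprime_factor (b := y.1.2) (Or.inl hy0)
  have h1 := y.2.1
  have h2 := y.2.2
  rw [hu, gnorm_mul, Nat.odd_mul] at h1
  rw [hv, gnorm_mul, Nat.odd_mul] at h2
  rw [← card_gaussianInt_units]
  refine card_fiber_of_simply_transitive scalePair y (⟨g, h1.1⟩, ⟨(u, v), hc, h1.2, h2.2⟩) ?_
    (fun e : GaussianIntˣ => (⟨(e⁻¹ : GaussianIntˣ) * g, by simpa using h1.1⟩,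
      ⟨(e * u, e * v), hc.units_mul e, by simpa using h1.2, by simpa using h2.2⟩)) ?_ ?_ ?_
  · exact Subtype.ext (Prod.ext hu.symm hv.symm)
  · intro e
    refine Subtype.ext (Prod.ext ?_ ?_)
    · rw [hu]
      simp only [scalePair]
      linear_combination g * u * e.inv_mul
    · rw [hv]
      simp only [scalePair]
      linear_combination g * v * e.inv_mul
  · intro e e' h
    simp only [Prod.mk.injEq, Subtype.mk.injEq] at h
    exact inv_injective (Units.ext (mul_right_cancel₀ hg h.1))
  · rintro ⟨⟨g', hg'⟩, ⟨⟨u', v'⟩, hc', hu', hv'⟩⟩ h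
    simp only [scalePair, Subtype.mk.injEq, Prod.mk.injEq] at h
    obtain ⟨e, he1, he2, he3⟩ := exists_unit_of_mul_eq hg hc hc' h.1.symm h.2.symm
    dsimp only at he1 he2
    exact ⟨e, by simp [he1, he2, he3]⟩

/-- The pairs with half norm sum `n`, sorted by the two norms. -/
theorem card_oddPair {n : ℕ} (hn : Odd n) :
    (Nat.card {x : OddPair // halfNorm x.1 = n} : ℤ) = 16 * ArithmeticFunction.sigma 1 n := by
  set S := (Finset.HasAntidiagonal.antidiagonal (2 * n)).filter (fun p => Odd p.1)
  have hS : ∀ p ∈ S, Odd p.1 ∧ Odd p.2 ∧ p.1 + p.2 = 2 * n := by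
    intro p hp
    simp only [S, Finset.mem_filter, Finset.HasAntidiagonal.mem_antidiagonal] at hp
    refine ⟨hp.2, ?_, hp.1⟩
    have := hp.2
    have := hp.1
    grind
  let e : {x : OddPair // halfNorm x.1 = n} ≃
      Σ p : S, {z // gnorm z = p.1.1} × {z // gnorm z = p.1.2} :=
    { toFun := fun x => ⟨⟨(gnorm x.1.1.1, gnorm x.1.1.2), by
          have := two_mul_halfNorm x.1.2.1 x.1.2.2
          rw [x.2] at this
          simp only [S, Finset.mem_filter, Finset.HasAntidiagonal.mem_antidiagonal]
          exact ⟨this.symm, x.1.2.1⟩⟩, ⟨x.1.1.1, rfl⟩, ⟨x.1.1.2, rfl⟩⟩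
      invFun := fun y => ⟨⟨(y.2.1.1, y.2.2.1), by
          rw [y.2.1.2, y.2.2.2]
          exact ⟨(hS _ y.1.2).1, (hS _ y.1.2).2.1⟩⟩, by
          simp only [halfNorm, y.2.1.2, y.2.2.2, (hS _ y.1.2).2.2]
          simp⟩
      left_inv := fun x => rfl
      right_inv := by
        rintro ⟨⟨⟨a, b⟩, h⟩, ⟨x, hx⟩, ⟨y, hy⟩⟩
        dsimp only at hx hy
        subst hx hy
        rfl }
  have hfin : ∀ p : S, Finite ({z // gnorm z = p.1.1} × {z // gnorm z = p.1.2}) := by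
    intro p
    have := finiteLevels_gnorm _ (hS _ p.2).1.pos.ne'
    have := finiteLevels_gnorm _ (hS _ p.2).2.1.pos.ne'
    infer_instance
  rw [Nat.card_congr e, Nat.card_sigma, ← sum_chiSum_eq_sigma hn]
  push_cast [Nat.card_prod]
  rw [Finset.sum_coe_sort S
    (fun p => ((Nat.card {x // gnorm x = p.1} : ℤ) * (Nat.card {y // gnorm y = p.2} : ℤ))),
    Finset.mul_sum]
  refine Finset.sum_congr rfl fun p hp => ?_
  have h1 := normCount_eq _ (hS p hp).1.pos.ne'
  have h2 := normCount_eq _ (hS p hp).2.1.pos.ne'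
  have h3 : ∀ k, Nat.card {z // gnorm z = k} = normCount k := fun _ => rfl
  rw [h3, h3, h1, h2]; ring

/-! ### Twisting by completely multiplicative functions -/

theorem pmul_mul_of_map_mul {h : ArithmeticFunction ℤ} (hh : ∀ m n, h (m * n) = h m * h n)
    (f g : ArithmeticFunction ℤ) : h.pmul (f * g) = h.pmul f * h.pmul g := by
  ext n
  simp only [ArithmeticFunction.pmul_apply, ArithmeticFunction.mul_apply, Finset.mul_sum]
  refine Finset.sum_congr rfl fun p hp => ?_
  rw [← (Nat.mem_divisorsAntidiagonal.mp hp).1, hh]; ring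

/-- The indicator function of the odd numbers. -/
def oddInd : ArithmeticFunction ℤ where
  toFun n := if Odd n then 1 else 0
  map_zero' := by simp

theorem oddInd_apply (n : ℕ) : oddInd n = if Odd n then 1 else 0 := rfl

theorem oddInd_mul (m n : ℕ) : oddInd (m * n) = oddInd m * oddInd n := by
  simp only [oddInd_apply, Nat.odd_mul]
  split_ifs <;> simp_all

theorem isMultiplicative_oddInd : oddInd.IsMultiplicative :=
  ⟨by simp [oddInd_apply], fun _ => oddInd_mul _ _⟩

theorem oddInd_pmul_chiFour : oddInd.pmul chiFour = chiFour := by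
  ext n
  rw [ArithmeticFunction.pmul_apply, oddInd_apply]
  split_ifs with h
  · simp
  · rw [chiFour_apply, ZMod.χ₄_nat_eq_if_mod_four, if_pos (by rw [Nat.odd_iff] at h; omega)]
    simp

open ArithmeticFunction in
/-- The twisted totient `n ↦ n * ∏ p ∣ n, (1 - χ p / p)` on odd `n`, and `0` on even `n`. -/
noncomputable def twistedTotient : ArithmeticFunction ℤ :=
  oddInd.pmul (ArithmeticFunction.id : ArithmeticFunction ℤ) * chiFour.pmul moebius

theorem ofNat_mul_apply (k : ℕ) (f : ArithmeticFunction ℤ) (n : ℕ) :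
    ((k : ArithmeticFunction ℤ) * f) n = k * f n := by
  induction k with
  | zero => simp
  | succ k ih =>
    push_cast
    rw [add_mul, add_mul, ArithmeticFunction.add_apply, ih, one_mul, one_mul]

theorem levelCount_oddPair :
    levelCount (fun x : OddPair => halfNorm x.1) =
      (16 : ℕ) * oddInd.pmul (ArithmeticFunction.sigma 1 : ArithmeticFunction ℤ) := by
  ext n
  rcases eq_or_ne n 0 with rfl | hn
  · simp
  rw [levelCount_apply _ hn, ofNat_mul_apply, ArithmeticFunction.pmul_apply, oddInd_apply]
  split_ifs with h
  · rw [card_oddPair h]; simp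
  · have : IsEmpty {x : OddPair // halfNorm x.1 = n} :=
      ⟨fun x => h (x.2 ▸ odd_halfNorm x.1.2.1 x.1.2.2)⟩
    simp

theorem levelCount_oddGaussian :
    levelCount (fun z : OddGaussian => gnorm z.1) = (4 : ℕ) * oddInd.pmul chiSum := by
  ext n
  rcases eq_or_ne n 0 with rfl | hn
  · simp
  rw [levelCount_apply _ hn, ofNat_mul_apply, ArithmeticFunction.pmul_apply, oddInd_apply]
  split_ifs with h
  · rw [one_mul]
    refine Eq.trans ?_ (normCount_eq n hn)
    rw [Nat.card_congr (β := {z // gnorm z = n})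
      { toFun := fun x => ⟨x.1.1, x.2⟩
        invFun := fun x => ⟨⟨x.1, by rw [x.2]; exact h⟩, x.2⟩
        left_inv := fun _ => rfl
        right_inv := fun _ => rfl }]
    rfl
  · have : IsEmpty {x : OddGaussian // gnorm x.1 = n} := ⟨fun x => h (x.2 ▸ x.1.2)⟩
    simp

open ArithmeticFunction in
/-- Sorting the pairs of odd norms by their common factor gives the convolution equation
`(odd part of ζ * χ) * C = 16 * (odd part of σ)` for the number `C` of coprime pairs; the factor on
the left has the inverse `(odd part of μ) * χ μ`. -/
theorem levelCount_coprimeOdd (n : ℕ) :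
    levelCount (fun x : CoprimeOdd => halfNorm x.1) n = 16 * twistedTotient n := by
  set C := levelCount (fun x : CoprimeOdd => halfNorm x.1)
  have h1 : ((4 : ℕ) : ArithmeticFunction ℤ) * oddInd.pmul chiSum * C =
      (4 : ℕ) * levelCount (fun x : OddPair => halfNorm x.1) := by
    rw [← levelCount_oddGaussian, ← levelCount_mul finiteLevels_oddGaussian finiteLevels_coprimeOdd]
    ext n
    rw [ofNat_mul_apply]
    exact levelCount_of_fiber scalePair halfNorm_scalePair
      (finiteLevels_mul finiteLevels_oddGaussian finiteLevels_coprimeOdd) four_ne_zero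
      (fun y _ => card_fiber_scalePair y) n
  have h2 : oddInd.pmul chiSum * C =
      (16 : ℕ) * oddInd.pmul (ArithmeticFunction.sigma 1 : ArithmeticFunction ℤ) := by
    rw [← levelCount_oddPair]
    ext n
    have := congrArg (fun f => f n) h1
    simp only [mul_assoc, ofNat_mul_apply] at this
    push_cast at this
    linarith
  have h3 : oddInd.pmul chiSum = oddInd.pmul (zeta : ArithmeticFunction ℤ) * chiFour := by
    rw [chiSum, pmul_mul_of_map_mul oddInd_mul, oddInd_pmul_chiFour]
  have h4 : oddInd.pmul (sigma 1 : ArithmeticFunction ℤ) =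
      oddInd.pmul (zeta : ArithmeticFunction ℤ) *
        oddInd.pmul (ArithmeticFunction.id : ArithmeticFunction ℤ) := by
    rw [← pmul_mul_of_map_mul oddInd_mul, ← zeta_mul_pow_eq_sigma, pow_one_eq_id, natCoe_mul]
  have h5 : oddInd.pmul (zeta : ArithmeticFunction ℤ) * oddInd.pmul moebius = 1 := by
    rw [← pmul_mul_of_map_mul oddInd_mul, coe_zeta_mul_moebius]
    ext n
    rcases eq_or_ne n 1 with rfl | hn
    · simp [oddInd_apply]
    · simp [hn]
  have h6 : chiFour * chiFour.pmul moebius = 1 := by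
    have : chiFour = chiFour.pmul (zeta : ArithmeticFunction ℤ) := by rw [pmul_zeta]
    nth_rewrite 1 [this]
    rw [← pmul_mul_of_map_mul chiFour_mul, coe_zeta_mul_moebius]
    ext n
    rcases eq_or_ne n 1 with rfl | hn
    · simp [chiFour_one]
    · simp [hn]
  have h7 : C = (16 : ℕ) * twistedTotient := by
    rw [h3, h4] at h2
    rw [twistedTotient]
    linear_combination (oddInd.pmul moebius * chiFour.pmul moebius) * h2 - C * h5 * chiFour *
      chiFour.pmul moebius - C * h6 + 16 *
        oddInd.pmul (ArithmeticFunction.id : ArithmeticFunction ℤ) * chiFour.pmul moebius * h5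
  rw [h7, ofNat_mul_apply]
  rfl

/-! ### Coprime pairs with norms of opposite parity -/

theorem gnorm_add_add_gnorm_sub (u v : GaussianInt) :
    gnorm (u + v) + gnorm (u - v) = 2 * (gnorm u + gnorm v) := by
  zify
  simp only [gnorm_cast']
  simp; ring

/-- The map `(u, v) ↦ (u + v, w * (u - v))` for `w = 1` and `w = i`. -/
def mixedToOdd (x : CoprimeMixed × Bool) : CoprimeOdd :=
  ⟨(x.1.1.1 + x.1.1.2, (if x.2 then gI else 1) * (x.1.1.1 - x.1.1.2)), by
    obtain ⟨⟨⟨u, v⟩, hc, ho⟩, b⟩ := x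
    dsimp only at hc ho ⊢
    have h1 := odd_gnorm_add.mpr ho
    have h2 := odd_gnorm_sub.mpr ho
    have hc' : IsCoprime (u + v) (u - v) := by
      obtain ⟨p, q, hpq⟩ := isCoprime_two h1
      obtain ⟨x, y, hxy⟩ := hc
      exact ⟨p + q * (x + y), q * (x - y), by linear_combination hpq + 2 * q * hxy⟩
    refine ⟨?_, h1, by cases b <;> simpa using h2⟩
    have hu : IsUnit (if b then gI else 1 : GaussianInt) := by
      cases b
      · simp
      · exact Zsqrtd.norm_eq_one_iff.mp gnorm_gI
    exact (isCoprime_mul_unit_left_right hu _ _).mpr hc'⟩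

theorem halfNorm_mixedToOdd (x : CoprimeMixed × Bool) :
    halfNorm (mixedToOdd x).1 = sumNorm x.1.1 := by
  obtain ⟨⟨⟨u, v⟩, hc, ho⟩, b⟩ := x
  have : gnorm (if b then gI else 1 : GaussianInt) = 1 := by cases b <;> rfl
  simp only [halfNorm, mixedToOdd, gnorm_mul, this, one_mul, gnorm_add_add_gnorm_sub, sumNorm]
  simp

theorem mixedToOdd_bijective : Function.Bijective mixedToOdd := by
  constructor
  · rintro ⟨⟨⟨u, v⟩, hc, ho⟩, b⟩ ⟨⟨⟨u', v'⟩, hc', ho'⟩, b'⟩ h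
    dsimp only at hc ho hc' ho'
    simp only [mixedToOdd, Subtype.mk.injEq, Prod.mk.injEq] at h
    obtain ⟨h1, h2⟩ := h
    have ho1 := odd_gnorm_iff.mp (odd_gnorm_add.mpr ho)
    simp only [Zsqrtd.ext_iff] at h1 h2
    cases b <;> cases b' <;> simp [gI] at h1 h2 ho1 <;>
      simp only [Prod.mk.injEq, Subtype.mk.injEq, Zsqrtd.ext_iff, and_true, Bool.true_eq_false,
        Bool.false_eq_true, and_false] <;> grind
  · rintro ⟨⟨s, t⟩, hc, hs, ht⟩
    dsimp only at hc hs ht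
    -- `s` and one of `t`, `-i * t` agree modulo `2`
    have key : ∀ (b : Bool) (d : GaussianInt), (if b then gI else 1) * d = t →
        (∃ k, s - d = 2 * k) → ∃ x, mixedToOdd x = ⟨(s, t), hc, hs, ht⟩ := by
      rintro b d hd ⟨k, hk⟩
      have hs' : s = (d + k) + k := by linear_combination hk
      refine ⟨(⟨(d + k, k), ?_, ?_⟩, b), ?_⟩
      · rw [← hd, hs'] at hc
        obtain ⟨x, y, hxy⟩ := hc
        exact ⟨x + y * (if b then gI else 1), x - y * (if b then gI else 1), by
          linear_combination hxy⟩
      · rw [hs'] at hs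
        exact odd_gnorm_add.mp hs
      · refine Subtype.ext (Prod.ext hs'.symm ?_)
        simp only [mixedToOdd, add_sub_cancel_right]
        exact hd
    have hs1 := odd_gnorm_iff.mp hs
    have ht1 := odd_gnorm_iff.mp ht
    by_cases h : Even (s.re - t.re)
    · refine key false t (by simp) ?_
      have h2 : Even (s.im - t.im) := by grind
      obtain ⟨a, ha⟩ := h
      obtain ⟨b, hb⟩ := h2
      exact ⟨⟨a, b⟩, by ext <;> simp <;> linarith⟩
    · refine key true (-gI * t) (by simp [← mul_assoc, gI_mul_gI]) ?_
      have h1 : Even (s.re - t.im) := by grind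
      have h2 : Even (s.im + t.re) := by grind
      obtain ⟨a, ha⟩ := h1
      obtain ⟨b, hb⟩ := h2
      exact ⟨⟨a, b⟩, by ext <;> simp [gI] <;> linarith⟩

theorem levelCount_coprimeMixed (n : ℕ) :
    levelCount (fun x : CoprimeMixed => sumNorm x.1) n = 8 * twistedTotient n := by
  rcases eq_or_ne n 0 with rfl | hn
  · simp
  have h := levelCount_coprimeOdd n
  rw [levelCount_apply _ hn] at h ⊢
  have e : {x : CoprimeMixed // sumNorm x.1 = n} × Bool ≃ {x : CoprimeOdd // halfNorm x.1 = n} :=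
    (Equiv.prodSubtypeFstEquivSubtypeProd
      (p := fun x : CoprimeMixed => sumNorm x.1 = n) (β := Bool)).symm.trans
      ((Equiv.ofBijective _ mixedToOdd_bijective).subtypeEquiv fun x => by
        rw [Equiv.ofBijective_apply, halfNorm_mixedToOdd])
  rw [← Nat.card_congr e, Nat.card_prod] at h
  simp only [Nat.card_eq_fintype_card, Fintype.card_bool] at h
  push_cast at h
  linarith

/-! ### Isotropic vectors over the Gaussian integers -/

/-- Isotropic vectors `(x, y, z)` with `x ^ 2 + y ^ 2 + z ^ 2 = 0` over the Gaussian integers, in the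
coordinates `A = x + i * y`, `B = x - i * y`, `z`; the condition `2 ∣ A - B` says that `x` and `y` are
integral. -/
abbrev IsotropicVec :=
  {t : GaussianInt × GaussianInt × GaussianInt // t.1 * t.2.1 = -t.2.2 ^ 2 ∧ 2 ∣ t.1 - t.2.1}

/-- Twice the Hermitian norm of an isotropic vector. -/
def isotropicNorm (t : IsotropicVec) : ℕ := gnorm t.1.1 + gnorm t.1.2.1 + 2 * gnorm t.1.2.2

/-- Parameters `(c, u, v)` of the isotropic vectors `A = c * u ^ 2`, `B = c * v ^ 2`,
`i * z = c * u * v`. -/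
abbrev IsotropicParam :=
  {t : GaussianInt × GaussianInt × GaussianInt //
    IsCoprime t.2.1 t.2.2 ∧ 2 ∣ t.1 * (t.2.1 ^ 2 - t.2.2 ^ 2)}

/-- The value of `isotropicNorm` at the vector with the given parameters. -/
def paramNorm (t : IsotropicParam) : ℕ := gnorm t.1.1 * sumNorm t.1.2 ^ 2

/-- The isotropic vector with given parameters. -/
def isotropicOfParam (t : IsotropicParam) : IsotropicVec :=
  ⟨(t.1.1 * t.1.2.1 ^ 2, t.1.1 * t.1.2.2 ^ 2, -gI * (t.1.1 * t.1.2.1 * t.1.2.2)),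
    by linear_combination t.1.1 ^ 2 * t.1.2.1 ^ 2 * t.1.2.2 ^ 2 * gI_mul_gI,
    by rw [← mul_sub]; exact t.2.2⟩

theorem isotropicNorm_ofParam (t : IsotropicParam) :
    isotropicNorm (isotropicOfParam t) = paramNorm t := by
  have h : gnorm (-gI) = 1 := rfl
  simp only [isotropicNorm, isotropicOfParam, paramNorm, sumNorm, gnorm_mul, h, pow_two]
  ring

/-- After division by the common factor of `A` and `B`, their product is a square up to sign, so each
is a square up to a unit; the unit of `A` goes into `c`. -/
theorem exists_param (A B z : GaussianInt) (h : A * B = -z ^ 2) (h0 : A ≠ 0 ∨ B ≠ 0) :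
    ∃ c u v, c ≠ 0 ∧ IsCoprime u v ∧ A = c * u ^ 2 ∧ B = c * v ^ 2 ∧ z = -gI * (c * u * v) := by
  obtain ⟨g, a, b, hg, rfl, rfl, hc⟩ := exists_coprime_factor h0
  obtain ⟨y, rfl⟩ : g ∣ z := by
    refine (IsIntegrallyClosed.pow_dvd_pow_iff (n := 2) two_ne_zero).mp ⟨-(a * b), ?_⟩
    linear_combination h
  have hab : a * b = (gI * y) ^ 2 := by
    refine mul_left_cancel₀ (pow_ne_zero 2 hg) ?_
    linear_combination h - g ^ 2 * y ^ 2 * gI_mul_gI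
  rcases eq_or_ne a 0 with rfl | ha
  · have hy : y = 0 := by
      have : (gI * y) ^ 2 = 0 := by rw [← hab, zero_mul]
      have := eq_zero_of_pow_eq_zero this
      have h2 := gI_mul_gI
      linear_combination -gI * this + y * h2
    have hb : IsUnit b := isCoprime_zero_left.mp hc
    exact ⟨g * b, 0, 1, mul_ne_zero hg hb.ne_zero, isCoprime_one_right, by ring, by ring, by
      rw [hy]; ring⟩
  obtain ⟨u, e, hu⟩ := exists_associated_pow_of_mul_eq_pow' hc hab
  -- `a = e * u ^ 2` forces `u ∣ i * y`, and then `b` is a square times the inverse of `e`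
  have hu0 : u ≠ 0 := by rintro rfl; exact ha (by rw [← hu]; ring)
  obtain ⟨w, hw⟩ : u ∣ gI * y := by
    refine (IsIntegrallyClosed.pow_dvd_pow_iff (n := 2) two_ne_zero).mp ⟨e * b, ?_⟩
    rw [← hab, ← hu]; ring
  have hb : e * b = w ^ 2 := by
    refine mul_left_cancel₀ (pow_ne_zero 2 hu0) ?_
    rw [hw, ← hu] at hab
    linear_combination hab
  have he := e.mul_inv
  have hb' : b = e * ((e⁻¹ : GaussianIntˣ) * w) ^ 2 := by
    refine mul_left_cancel₀ e.ne_zero ?_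
    rw [hb]
    linear_combination -(w ^ 2) * (e * (e⁻¹ : GaussianIntˣ) + 1) * he
  have hy : y = -gI * (u * w) := by
    linear_combination -gI * hw + y * gI_mul_gI
  refine ⟨g * e, u, (e⁻¹ : GaussianIntˣ) * w, mul_ne_zero hg e.ne_zero, ?_, ?_, ?_, ?_⟩
  · rw [← hu, hb'] at hc
    exact (IsCoprime.pow_iff two_pos two_pos).mp hc.of_mul_left_left.of_mul_right_right
  · rw [← hu]; ring
  · nth_rewrite 1 [hb']; ring
  · rw [hy]; linear_combination gI * g * u * w * he

/-- The parameters of a nonzero isotropic vector are unique up to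
`(c, u, v) ↦ (e⁻¹ ^ 2 * c, e * u, e * v)` for a unit `e`. -/
theorem exists_unit_of_param_eq {c u v c' u' v' : GaussianInt} (hc : c ≠ 0) (h : IsCoprime u v)
    (h' : IsCoprime u' v') (h1 : c * u ^ 2 = c' * u' ^ 2) (h2 : c * v ^ 2 = c' * v' ^ 2)
    (h3 : c * u * v = c' * u' * v') :
    ∃ e : GaussianIntˣ, u' = e * u ∧ v' = e * v ∧ c' = (e⁻¹ : GaussianIntˣ) ^ 2 * c := by
  have key : u' * v = v' * u := by
    have hu : (c * u) * (u' * v) = (c * u) * (v' * u) := by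
      linear_combination u' * h3 - v' * h1
    have hv : (c * v) * (u' * v) = (c * v) * (v' * u) := by
      linear_combination u' * h2 - v' * h3
    obtain ⟨a, b, hab⟩ := h
    refine mul_left_cancel₀ hc ?_
    linear_combination a * hu + b * hv - (c * (u' * v) - c * (v' * u)) * hab
  -- the two vectors `(u, v)` and `(u', v')` are proportional, and both are primitive
  obtain ⟨a, b, hab⟩ := id h
  obtain ⟨a', b', hab'⟩ := id h'
  obtain ⟨e, he1, he2, he3⟩ := exists_unit_of_mul_eq
    (g := a' * u' + b' * v') (g' := a' * u + b' * v)
    (by rw [hab']; exact one_ne_zero) h h' (by linear_combination -b' * key)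
    (by linear_combination a' * key)
  refine ⟨e, he1, he2, ?_⟩
  have h4 : c * (a * u + b * v) ^ 2 = c' * e ^ 2 * (a * u + b * v) ^ 2 := by
    rw [he1] at h1 h3
    rw [he2] at h2 h3
    linear_combination a ^ 2 * h1 + b ^ 2 * h2 + 2 * a * b * h3
  rw [hab] at h4
  have he := e.inv_mul
  linear_combination -(e⁻¹ : GaussianIntˣ) ^ 2 * h4 - c' * ((e⁻¹ : GaussianIntˣ) * e + 1) * he

theorem card_fiber_isotropicOfParam (y : IsotropicVec) (hy : isotropicNorm y ≠ 0) :
    Nat.card {x // isotropicOfParam x = y} = 4 := by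
  obtain ⟨⟨A, B, z⟩, h1, h2⟩ := y
  dsimp only at h1 h2
  have h0 : A ≠ 0 ∨ B ≠ 0 := by
    by_contra! h
    obtain ⟨rfl, rfl⟩ := h
    have hz : z = 0 := by
      refine eq_zero_of_pow_eq_zero (n := 2) ?_
      linear_combination h1
    exact hy (by simp [isotropicNorm, hz])
  obtain ⟨c, u, v, hc0, hc, rfl, rfl, rfl⟩ := exists_param A B z h1 h0
  rw [← card_gaussianInt_units]
  refine card_fiber_of_simply_transitive isotropicOfParam _
    ⟨(c, u, v), hc, by rwa [← mul_sub] at h2⟩ rfl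
    (fun e : GaussianIntˣ => ⟨((e⁻¹ : GaussianIntˣ) ^ 2 * c, e * u, e * v), hc.units_mul e, ?_⟩)
    ?_ ?_ ?_
  · have : ((e⁻¹ : GaussianIntˣ) : GaussianInt) ^ 2 * c * ((e * u) ^ 2 - (e * v) ^ 2) =
        c * u ^ 2 - c * v ^ 2 := by
      linear_combination c * (u ^ 2 - v ^ 2) * ((e⁻¹ : GaussianIntˣ) * e + 1) * e.inv_mul
    dsimp only
    rwa [this]
  · intro e
    have he : ((e⁻¹ : GaussianIntˣ) : GaussianInt) ^ 2 * e ^ 2 = 1 := by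
      rw [← mul_pow, e.inv_mul, one_pow]
    refine Subtype.ext (Prod.ext ?_ (Prod.ext ?_ ?_)) <;> simp only [isotropicOfParam]
    · linear_combination c * u ^ 2 * he
    · linear_combination c * v ^ 2 * he
    · linear_combination -gI * c * u * v * he
  · intro e e' h
    simp only [Prod.mk.injEq, Subtype.mk.injEq] at h
    obtain ⟨-, hu, hv⟩ := h
    obtain ⟨a, b, hab⟩ := hc
    refine Units.ext ?_
    linear_combination a * hu + b * hv + (e' - e : GaussianInt) * hab
  · rintro ⟨⟨c', u', v'⟩, hc', h2'⟩ h
    simp only [isotropicOfParam, Subtype.mk.injEq, Prod.mk.injEq] at h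
    obtain ⟨h3, h4, h5⟩ := h
    have h5' : c * u * v = c' * u' * v' := by
      have := gI_mul_gI
      linear_combination -gI * h5 + (c * u * v - c' * u' * v') * this
    obtain ⟨e, rfl, rfl, rfl⟩ := exists_unit_of_param_eq hc0 hc hc' h3.symm h4.symm h5'
    exact ⟨e, rfl⟩

theorem two_dvd_mul_of_odd {u v : GaussianInt} (hu : Odd (gnorm u)) (hv : Odd (gnorm v)) :
    2 ∣ u ^ 2 - v ^ 2 := by
  have h : ¬ Odd (gnorm u + gnorm v) := by
    rw [Nat.not_odd_iff_even]; exact hu.add_odd hv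
  have h1 : gTwo ∣ u + v := by
    rw [gTwo_dvd_iff, ← Nat.not_odd_iff_even, odd_gnorm_add]; exact h
  have h2 : gTwo ∣ u - v := by
    rw [gTwo_dvd_iff, ← Nat.not_odd_iff_even, odd_gnorm_sub]; exact h
  obtain ⟨k, hk⟩ := mul_dvd_mul h1 h2
  have h3 : gTwo * gTwo = 2 * gI := by ext <;> rfl
  refine ⟨gI * k, ?_⟩
  rw [h3] at hk
  linear_combination hk

theorem odd_of_even_sumNorm {u v : GaussianInt} (hc : IsCoprime u v)
    (h : ¬ Odd (gnorm u + gnorm v)) : Odd (gnorm u) ∧ Odd (gnorm v) := by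
  have h1 : ¬ (Even (gnorm u) ∧ Even (gnorm v)) := by
    rintro ⟨hu, hv⟩
    rw [← gTwo_dvd_iff] at hu hv
    have := hc.isUnit_of_dvd' hu hv
    rw [← Zsqrtd.norm_eq_one_iff] at this
    exact absurd this (by decide)
  grind

/-- The parameters of norm `4 * M`: either `u`, `v` have norms of opposite parity, and then `c` is
divisible by `2`, or both norms are odd, and then `c` is arbitrary. -/
theorem paramNorm_sum (M : ℕ) :
    Nonempty (({x : GaussianInt × CoprimeMixed // gnorm x.1 * sumNorm x.2.1 ^ 2 = M} ⊕
      {x : GaussianInt × CoprimeOdd // gnorm x.1 * halfNorm x.2.1 ^ 2 = M}) ≃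
        {t : IsotropicParam // paramNorm t = 4 * M}) := by
  have hodd : ∀ p : CoprimeOdd, 4 * halfNorm p.1 ^ 2 = sumNorm p.1 ^ 2 := by
    intro p
    have : sumNorm p.1 = 2 * halfNorm p.1 := (two_mul_halfNorm p.2.2.1 p.2.2.2).symm
    rw [this]; ring
  have h2 : gnorm 2 = 4 := rfl
  refine ⟨Equiv.ofBijective (Sum.elim
    (fun x => ⟨⟨(2 * x.1.1, x.1.2.1), x.1.2.2.1, by
      rw [mul_assoc]; exact dvd_mul_right _ _⟩, ?_⟩)
    (fun x => ⟨⟨(x.1.1, x.1.2.1), x.1.2.2.1,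
      (two_dvd_mul_of_odd x.1.2.2.2.1 x.1.2.2.2.2).mul_left _⟩, ?_⟩)) ⟨?_, ?_⟩⟩
  · rw [paramNorm, gnorm_mul, h2, mul_assoc, x.2]
  · rw [paramNorm, ← hodd]; linear_combination 4 * x.2
  · have sep : ∀ (x : CoprimeMixed) (y : CoprimeOdd), x.1 ≠ y.1 := by
      intro x y h
      have h1 := x.2.2
      rw [h] at h1
      exact absurd (y.2.2.1.add_odd y.2.2.2) (Nat.not_even_iff_odd.mpr h1)
    rintro (⟨⟨c, p⟩, hx⟩ | ⟨⟨c, p⟩, hx⟩) (⟨⟨c', p'⟩, hx'⟩ | ⟨⟨c', p'⟩, hx'⟩) h <;>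
      simp only [Sum.elim_inl, Sum.elim_inr, Subtype.mk.injEq, Prod.mk.injEq] at h
    · simp [mul_left_cancel₀ two_ne_zero h.1, Subtype.ext h.2]
    · exact absurd h.2 (sep _ _)
    · exact absurd h.2.symm (sep _ _)
    · simp [h.1, Subtype.ext h.2]
  · rintro ⟨⟨⟨c, u, v⟩, hc, hd⟩, hM⟩
    dsimp only at hc hd
    by_cases ho : Odd (gnorm u + gnorm v)
    · have hcop : IsCoprime (2 : GaussianInt) (u ^ 2 - v ^ 2) := by
        refine (isCoprime_two ?_).symm
        rw [sq_sub_sq, gnorm_mul]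
        exact (odd_gnorm_add.mpr ho).mul (odd_gnorm_sub.mpr ho)
      obtain ⟨k, rfl⟩ := hcop.dvd_of_dvd_mul_right hd
      refine ⟨Sum.inl ⟨(k, ⟨(u, v), hc, ho⟩), ?_⟩, rfl⟩
      rw [paramNorm, gnorm_mul, h2, mul_assoc] at hM
      exact Nat.eq_of_mul_eq_mul_left four_pos hM
    · refine ⟨Sum.inr ⟨(c, ⟨(u, v), hc, odd_of_even_sumNorm hc ho⟩), ?_⟩, rfl⟩
      refine Nat.eq_of_mul_eq_mul_left four_pos ?_
      rw [← hM, paramNorm, ← hodd ⟨(u, v), hc, odd_of_even_sumNorm hc ho⟩]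
      ring

/-! ### Functions supported on the squares -/

/-- The arithmetic function with value `f k` at `k ^ 2`, and `0` at nonsquares. -/
def onSquares (f : ArithmeticFunction ℤ) : ArithmeticFunction ℤ where
  toFun n := if IsSquare n then f (Nat.sqrt n) else 0
  map_zero' := by simp

theorem onSquares_apply (f : ArithmeticFunction ℤ) (n : ℕ) :
    onSquares f n = if IsSquare n then f (Nat.sqrt n) else 0 := rfl

theorem onSquares_sq (f : ArithmeticFunction ℤ) (n : ℕ) : onSquares f (n ^ 2) = f n := by
  rw [onSquares_apply, if_pos ⟨n, sq n⟩, Nat.sqrt_eq']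

theorem onSquares_of_not_isSquare (f : ArithmeticFunction ℤ) {n : ℕ} (h : ¬ IsSquare n) :
    onSquares f n = 0 := if_neg h

theorem levelCount_sq {α : Type*} (f : α → ℕ) :
    levelCount (fun x => f x ^ 2) = onSquares (levelCount f) := by
  ext n
  rcases eq_or_ne n 0 with rfl | hn
  · simp
  rw [levelCount_apply _ hn]
  by_cases h : IsSquare n
  · obtain ⟨k, rfl⟩ := h
    rw [← sq] at hn ⊢
    have hk : k ≠ 0 := by rintro rfl; exact hn rfl
    rw [onSquares_sq, levelCount_apply _ hk,
      Nat.card_congr (Equiv.subtypeEquivRight fun x => (Nat.pow_left_injective two_ne_zero).eq_iff)]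
  · have : IsEmpty {x // f x ^ 2 = n} := ⟨fun x => h ⟨f x.1, by rw [← sq]; exact x.2.symm⟩⟩
    simp [onSquares_of_not_isSquare _ h]

theorem finiteLevels_sq {α : Type*} {f : α → ℕ} (hf : FiniteLevels f) :
    FiniteLevels fun x => f x ^ 2 := by
  intro n hn
  by_cases h : IsSquare n
  · obtain ⟨k, rfl⟩ := h
    have hk : k ≠ 0 := by rintro rfl; exact hn rfl
    have := hf k hk
    refine Finite.of_equiv {x // f x = k} (Equiv.subtypeEquivRight fun x => ?_)
    rw [← sq, (Nat.pow_left_injective two_ne_zero).eq_iff]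
  · have : IsEmpty {x // f x ^ 2 = n} := ⟨fun x => h ⟨f x.1, by rw [← sq]; exact x.2.symm⟩⟩
    infer_instance

/-- The arithmetic function `Twin M / 24`, as a Dirichlet product. -/
noncomputable def twinConv : ArithmeticFunction ℤ := chiSum * onSquares twistedTotient

theorem onSquares_mul (k : ℕ) (f : ArithmeticFunction ℤ) :
    onSquares ((k : ArithmeticFunction ℤ) * f) = (k : ArithmeticFunction ℤ) * onSquares f := by
  ext n
  simp only [onSquares_apply, ofNat_mul_apply]
  split_ifs <;> simp

theorem card_isotropic {M : ℕ} (hM : M ≠ 0) :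
    Finite {t : IsotropicVec // isotropicNorm t = 4 * M} ∧
      (Nat.card {t : IsotropicVec // isotropicNorm t = 4 * M} : ℤ) = 24 * twinConv M := by
  obtain ⟨e⟩ := paramNorm_sum M
  have hf1 := finiteLevels_mul finiteLevels_gnorm (finiteLevels_sq finiteLevels_coprimeMixed)
  have hf2 := finiteLevels_mul finiteLevels_gnorm (finiteLevels_sq finiteLevels_coprimeOdd)
  have := hf1 M hM
  have := hf2 M hM
  have hfin : Finite {t : IsotropicParam // paramNorm t = 4 * M} := Finite.of_equiv _ e
  have h4M : 4 * M ≠ 0 := by omega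
  obtain ⟨h1, h2⟩ := card_level_of_fiber isotropicOfParam isotropicNorm_ofParam hfin four_ne_zero
    fun y hy => card_fiber_isotropicOfParam y (hy ▸ h4M)
  refine ⟨h1, ?_⟩
  rw [← Nat.card_congr e, Nat.card_sum] at h2
  have h3 : levelCount (fun x : GaussianInt × CoprimeMixed => gnorm x.1 * sumNorm x.2.1 ^ 2) M =
      32 * twinConv M := by
    have : levelCount (fun x : CoprimeMixed => sumNorm x.1) = (8 : ℕ) * twistedTotient := by
      ext n; rw [levelCount_coprimeMixed, ofNat_mul_apply]; rfl
    rw [levelCount_mul finiteLevels_gnorm (finiteLevels_sq finiteLevels_coprimeMixed),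
      levelCount_gnorm, levelCount_sq, this, onSquares_mul,
      show (4 * chiSum) * (((8 : ℕ) : ArithmeticFunction ℤ) * onSquares twistedTotient) =
        (32 : ℕ) * twinConv by rw [twinConv]; push_cast; ring, ofNat_mul_apply]
    rfl
  have h5 : levelCount (fun x : GaussianInt × CoprimeOdd => gnorm x.1 * halfNorm x.2.1 ^ 2) M =
      64 * twinConv M := by
    have : levelCount (fun x : CoprimeOdd => halfNorm x.1) = (16 : ℕ) * twistedTotient := by
      ext n; rw [levelCount_coprimeOdd, ofNat_mul_apply]; rfl
    rw [levelCount_mul finiteLevels_gnorm (finiteLevels_sq finiteLevels_coprimeOdd),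
      levelCount_gnorm, levelCount_sq, this, onSquares_mul,
      show (4 * chiSum) * (((16 : ℕ) : ArithmeticFunction ℤ) * onSquares twistedTotient) =
        (64 : ℕ) * twinConv by rw [twinConv]; push_cast; ring, ofNat_mul_apply]
    rfl
  rw [levelCount_apply _ hM] at h3 h5
  have h6 := congrArg (Nat.cast : ℕ → ℤ) h2
  rw [Nat.cast_add, Nat.cast_mul, Nat.cast_ofNat] at h6
  linarith

/-! ### Twin pairs as isotropic vectors -/

theorem isPureQuat_iff {θ : ℍ[ℤ]} : IsPureQuat θ ↔ θ.re = 0 := by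
  rw [IsPureQuat, Quaternion.ext_iff]
  simp

theorem mem_twinPairs {M : ℕ} (hM : M ≠ 0) {x : ℍ[ℤ] × ℍ[ℤ]} :
    x ∈ twinPairs M ↔ x.1.re = 0 ∧ x.2.re = 0 ∧
      x.1.imI ^ 2 + x.1.imJ ^ 2 + x.1.imK ^ 2 = (M : ℤ) ∧
      x.2.imI ^ 2 + x.2.imJ ^ 2 + x.2.imK ^ 2 = (M : ℤ) ∧
      x.1.imI * x.2.imI + x.1.imJ * x.2.imJ + x.1.imK * x.2.imK = 0 := by
  have hM' : (M : ℤ) ≠ 0 := by exact_mod_cast hM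
  obtain ⟨θ, η⟩ := x
  simp only [twinPairs, Set.mem_ofPred_eq, Quaternion.normSq_def']
  constructor
  · rintro ⟨⟨-, -, h1, h2, -, h3⟩, h4, h5⟩
    rw [isPureQuat_iff] at h1 h2 h3
    rw [Quaternion.re_mul] at h3
    rw [h1] at h4 h3
    rw [h2] at h5
    exact ⟨h1, h2, by linarith, by linarith, by linarith⟩
  · rintro ⟨h1, h2, h3, h4, h5⟩
    have h6 : Quaternion.normSq θ = M := by rw [Quaternion.normSq_def', h1]; linarith
    have h7 : Quaternion.normSq η = M := by rw [Quaternion.normSq_def', h2]; linarith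
    refine ⟨⟨?_, ?_, isPureQuat_iff.mpr h1, isPureQuat_iff.mpr h2, h6.trans h7.symm, ?_⟩, ?_, ?_⟩
    · rintro rfl; exact hM' (by rw [← h6, map_zero])
    · rintro rfl; exact hM' (by rw [← h7, map_zero])
    · rw [isPureQuat_iff, Quaternion.re_mul, h1]; linarith
    · rw [h1]; linarith
    · rw [h2]; linarith

/-- The isotropic vector `θ + i * η`. -/
def isotropicOfTwin (x : ℍ[ℤ] × ℍ[ℤ]) : GaussianInt × GaussianInt × GaussianInt :=
  (⟨x.1.imI - x.2.imJ, x.2.imI + x.1.imJ⟩, ⟨x.1.imI + x.2.imJ, x.2.imI - x.1.imJ⟩,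
    ⟨x.1.imK, x.2.imK⟩)

theorem twinPairs_equiv {M : ℕ} (hM : M ≠ 0) :
    Nonempty (twinPairs M ≃ {t : IsotropicVec // isotropicNorm t = 4 * M}) := by
  refine ⟨Equiv.ofBijective (fun x => ⟨⟨isotropicOfTwin x.1, ?_, ?_⟩, ?_⟩) ⟨?_, ?_⟩⟩
  · obtain ⟨h1, h2, h3, h4, h5⟩ := (mem_twinPairs hM).mp x.2
    ext <;> simp [isotropicOfTwin, sq]
    · linarith
    · linarith
  · exact ⟨⟨-x.1.2.imJ, x.1.1.imJ⟩, by ext <;> simp [isotropicOfTwin] <;> ring⟩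
  · obtain ⟨h1, h2, h3, h4, h5⟩ := (mem_twinPairs hM).mp x.2
    zify
    simp only [isotropicNorm, isotropicOfTwin]
    push_cast
    simp only [gnorm_cast']
    linarith
  · rintro ⟨⟨θ, η⟩, hx⟩ ⟨⟨θ', η'⟩, hx'⟩ h
    obtain ⟨h1, h2, -⟩ := (mem_twinPairs hM).mp hx
    obtain ⟨h1', h2', -⟩ := (mem_twinPairs hM).mp hx'
    simp only [isotropicOfTwin, Subtype.mk.injEq, Prod.mk.injEq, Zsqrtd.ext_iff] at h h1 h2 h1' h2'
    simp only [Subtype.mk.injEq, Prod.mk.injEq, Quaternion.ext_iff]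
    omega
  · rintro ⟨⟨⟨A, B, z⟩, h1, ⟨k, h2⟩⟩, h3⟩
    dsimp only at h1 h2
    have hB : B = A - 2 * k := by linear_combination -h2
    subst hB
    let x : ℍ[ℤ] × ℍ[ℤ] := (⟨0, A.re - k.re, k.im, z.re⟩, ⟨0, A.im - k.im, -k.re, z.im⟩)
    have hx : isotropicOfTwin x = (A, A - 2 * k, z) := by
      simp only [isotropicOfTwin, x, Prod.mk.injEq, Zsqrtd.ext_iff]
      simp
      constructor <;> ring
    refine ⟨⟨x, ?_⟩, Subtype.ext (Subtype.ext hx)⟩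
    rw [mem_twinPairs hM]
    rw [isotropicNorm] at h3
    zify at h3
    simp only [gnorm_cast'] at h3
    rw [Zsqrtd.ext_iff] at h1
    simp [sq] at h1 h3
    obtain ⟨h4, h5⟩ := h1
    simp only [x, true_and]
    refine ⟨?_, ?_, ?_⟩ <;> linarith

theorem twin_finite_and_eq {M : ℕ} (hM : M ≠ 0) :
    (twinPairs M).Finite ∧ (Twin M : ℤ) = 24 * twinConv M := by
  obtain ⟨e⟩ := twinPairs_equiv hM
  obtain ⟨h1, h2⟩ := card_isotropic hM
  refine ⟨?_, ?_⟩
  · have : Finite (twinPairs M) := Finite.of_equiv _ e.symm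
    exact Set.toFinite _
  · rw [← h2, ← Nat.card_congr e, Twin, Nat.card_coe_set_eq]

/-! ### Values at prime powers -/

theorem isMultiplicative_chiSum : chiSum.IsMultiplicative :=
  ArithmeticFunction.isMultiplicative_zeta.natCast.mul isMultiplicative_chiFour

theorem isMultiplicative_twistedTotient : twistedTotient.IsMultiplicative :=
  (isMultiplicative_oddInd.pmul ArithmeticFunction.isMultiplicative_id.natCast).mul
    (isMultiplicative_chiFour.pmul ArithmeticFunction.isMultiplicative_moebius)

theorem isMultiplicative_onSquares {f : ArithmeticFunction ℤ} (hf : f.IsMultiplicative) :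
    (onSquares f).IsMultiplicative := by
  refine ⟨by simpa [hf.map_one] using onSquares_sq f 1, ?_⟩
  intro m n hmn
  by_cases h : IsSquare m ∧ IsSquare n
  · obtain ⟨⟨a, rfl⟩, ⟨b, rfl⟩⟩ := h
    have hab : a.Coprime b := hmn.coprime_mul_left.coprime_mul_left_right
    rw [← sq, ← sq, ← mul_pow, onSquares_sq, onSquares_sq, onSquares_sq, hf.map_mul_of_coprime hab]
  · have hmn' : ¬ IsSquare (m * n) := by
      intro hs
      refine h ⟨?_, ?_⟩
      · obtain ⟨c, hc⟩ := hs
        obtain ⟨d, hd⟩ := exists_eq_pow_of_mul_eq_pow (Nat.isUnit_iff.mpr hmn)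
          (hc.trans (sq c).symm)
        exact ⟨d, hd.trans (sq d)⟩
      · obtain ⟨c, hc⟩ := hs
        rw [mul_comm] at hc
        obtain ⟨d, hd⟩ := exists_eq_pow_of_mul_eq_pow (Nat.isUnit_iff.mpr hmn.symm)
          (hc.trans (sq c).symm)
        exact ⟨d, hd.trans (sq d)⟩
    rw [onSquares_of_not_isSquare f hmn']
    rw [not_and_or] at h
    rcases h with h | h
    · rw [onSquares_of_not_isSquare f h, zero_mul]
    · rw [onSquares_of_not_isSquare f h, mul_zero]

theorem isMultiplicative_twinConv : twinConv.IsMultiplicative :=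
  isMultiplicative_chiSum.mul (isMultiplicative_onSquares isMultiplicative_twistedTotient)

theorem mul_apply_prime_pow (f g : ArithmeticFunction ℤ) {p : ℕ} (hp : p.Prime) (e : ℕ) :
    (f * g) (p ^ e) = ∑ i ∈ Finset.range (e + 1), f (p ^ i) * g (p ^ (e - i)) := by
  rw [ArithmeticFunction.mul_apply, Nat.sum_divisorsAntidiagonal (f := fun a b => f a * g b),
    Nat.sum_divisors_prime_pow hp]
  refine Finset.sum_congr rfl fun i hi => ?_
  rw [Nat.pow_div (Nat.lt_succ_iff.mp (Finset.mem_range.mp hi)) hp.pos]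

theorem chiFour_pow (p i : ℕ) : chiFour (p ^ i) = chiFour p ^ i := by
  simp only [chiFour_apply, Nat.cast_pow, map_pow]

theorem chiSum_prime_pow {p : ℕ} (hp : p.Prime) (i : ℕ) :
    chiSum (p ^ i) = ∑ j ∈ Finset.range (i + 1), chiFour p ^ j := by
  rw [chiSum_apply, Nat.sum_divisors_prime_pow hp]
  simp only [chiFour_pow]

theorem twistedTotient_prime_pow_succ {p : ℕ} (hp : p.Prime) (j : ℕ) :
    twistedTotient (p ^ (j + 1)) =
      oddInd (p ^ (j + 1)) * p ^ (j + 1) - chiFour p * (oddInd (p ^ j) * p ^ j) := by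
  rw [twistedTotient, mul_comm, mul_apply_prime_pow _ _ hp, Finset.sum_range_succ',
    Finset.sum_range_succ', Finset.sum_eq_zero]
  · simp [ArithmeticFunction.moebius_apply_prime hp, chiFour_one]
    ring
  · intro i _
    rw [ArithmeticFunction.pmul_apply, ArithmeticFunction.moebius_apply_prime_pow hp (by omega),
      if_neg (by omega), mul_zero, zero_mul]

theorem sum_range_of_odd_eq_zero (g : ℕ → ℤ) (L : ℕ) (hg : ∀ j ≤ L, g (2 * j + 1) = 0) :
    ∑ i ∈ Finset.range (2 * L + 1), g i = ∑ j ∈ Finset.range (L + 1), g (2 * j) := by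
  induction L with
  | zero => simp
  | succ L ih =>
    rw [Finset.sum_range_succ _ (L + 1), ← ih fun j hj => hg j (by omega),
      show 2 * (L + 1) + 1 = 2 * L + 1 + 1 + 1 by ring, Finset.sum_range_succ,
      Finset.sum_range_succ, hg L (by omega), add_zero]
    rfl

theorem twinConv_prime_pow {p : ℕ} (hp : p.Prime) {e : ℕ} (L b : ℕ) (hb : b < 2)
    (he : e = 2 * L + b) :
    twinConv (p ^ e) =
      ∑ j ∈ Finset.range (L + 1), twistedTotient (p ^ j) * chiSum (p ^ (2 * (L - j) + b)) := by
  have hodd : ∀ j, onSquares twistedTotient (p ^ (2 * j + 1)) = 0 := by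
    intro j
    refine onSquares_of_not_isSquare _ fun ⟨c, hc⟩ => ?_
    have := congrArg (fun n => n.factorization p) hc
    have hc0 : c ≠ 0 := by rintro rfl; exact pow_ne_zero _ hp.ne_zero hc
    simp only [hp.factorization_pow, Nat.factorization_mul hc0 hc0, Finsupp.add_apply,
      Finsupp.single_eq_same] at this
    omega
  rw [twinConv, mul_comm, mul_apply_prime_pow _ _ hp]
  have h1 : ∑ i ∈ Finset.range (e + 1), onSquares twistedTotient (p ^ i) * chiSum (p ^ (e - i)) =
      ∑ i ∈ Finset.range (2 * L + 1),
        onSquares twistedTotient (p ^ i) * chiSum (p ^ (e - i)) := by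
    interval_cases b
    · rw [he]
    · rw [he, Finset.sum_range_succ, hodd, zero_mul, add_zero]
  rw [h1, sum_range_of_odd_eq_zero _ _ fun j _ => by rw [hodd, zero_mul]]
  refine Finset.sum_congr rfl fun j hj => ?_
  have := Finset.mem_range.mp hj
  rw [show p ^ (2 * j) = (p ^ j) ^ 2 by rw [← pow_mul, mul_comm], onSquares_sq,
    show e - 2 * j = 2 * (L - j) + b by omega]

theorem twinConv_two_pow (k : ℕ) : twinConv (2 ^ k) = 1 := by
  have h2 : chiFour 2 = 0 := rfl
  have hs : ∀ i, chiSum (2 ^ i) = 1 := by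
    intro i
    rw [chiSum_prime_pow Nat.prime_two, Finset.sum_range_succ', h2]
    simp
  rw [twinConv_prime_pow Nat.prime_two (k / 2) (k % 2) (Nat.mod_lt _ two_pos)
    (Nat.div_add_mod k 2).symm, Finset.sum_range_succ', Finset.sum_eq_zero]
  · simp [hs, isMultiplicative_twistedTotient.map_one]
  · intro i _
    rw [twistedTotient_prime_pow_succ Nat.prime_two, h2, oddInd_apply, if_neg (by simp [pow_succ])]
    simp

theorem twistedTotient_odd_prime_pow {p : ℕ} (hp : p.Prime) (h : Odd p) (j : ℕ) :
    twistedTotient (p ^ (j + 1)) = p ^ (j + 1) - chiFour p * p ^ j := by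
  rw [twistedTotient_prime_pow_succ hp, oddInd_apply, oddInd_apply, if_pos h.pow, if_pos h.pow]
  ring

theorem sum_twistedTotient_split {p : ℕ} (hp : p.Prime) (h : p % 4 = 1) (L : ℕ) :
    ∑ j ∈ Finset.range (L + 1), twistedTotient (p ^ j) = p ^ L := by
  have hc : chiFour p = 1 := ZMod.χ₄_nat_one_mod_four h
  induction L with
  | zero => simp [isMultiplicative_twistedTotient.map_one]
  | succ L ih =>
    rw [Finset.sum_range_succ, ih,
      twistedTotient_odd_prime_pow hp (Nat.odd_of_mod_four_eq_one h |> Nat.odd_iff.mpr), hc]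
    ring

/-- By induction on `L`: each step adds twice a partial sum of `twistedTotient` over the powers of `p`,
which is `p ^ L`, and a last term with weight `k`. -/
theorem weighted_sum_twistedTotient {p : ℕ} (hp : p.Prime) (h : p % 4 = 1) (L : ℕ) (k : ℤ) :
    ∑ j ∈ Finset.range (L + 1), twistedTotient (p ^ j) * (2 * ((L - j : ℕ) : ℤ) + k) =
      2 * ∑ j ∈ Finset.range L, (p : ℤ) ^ j + k * p ^ L := by
  have hc : chiFour p = 1 := ZMod.χ₄_nat_one_mod_four h
  induction L with
  | zero => simp [isMultiplicative_twistedTotient.map_one]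
  | succ L ih =>
    have h1 : ∀ j ∈ Finset.range (L + 1),
        twistedTotient (p ^ j) * (2 * ((L + 1 - j : ℕ) : ℤ) + k) =
          twistedTotient (p ^ j) * (2 * ((L - j : ℕ) : ℤ) + k) + 2 * twistedTotient (p ^ j) := by
      intro j hj
      have := Finset.mem_range.mp hj
      rw [show L + 1 - j = (L - j) + 1 by omega]
      push_cast; ring
    rw [Finset.sum_range_succ, Finset.sum_congr rfl h1, Finset.sum_add_distrib, ih,
      ← Finset.mul_sum, sum_twistedTotient_split hp h,
      twistedTotient_odd_prime_pow hp (Nat.odd_iff.mpr (Nat.odd_of_mod_four_eq_one h)), hc,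
      Finset.sum_range_succ]
    simp only [Nat.sub_self, Nat.cast_zero]
    ring

theorem sigma_prime_pow_cast {p : ℕ} (hp : p.Prime) (i : ℕ) :
    ((ArithmeticFunction.sigma 1 (p ^ i) : ℕ) : ℤ) = ∑ j ∈ Finset.range (i + 1), (p : ℤ) ^ j := by
  rw [ArithmeticFunction.sigma_one_apply_prime_pow hp]
  push_cast
  rfl

theorem twinConv_split {p : ℕ} (hp : p.Prime) (h : p % 4 = 1) {e : ℕ} (he : 0 < e) :
    twinConv (p ^ e) = twinG p e := by
  have hc : chiFour p = 1 := ZMod.χ₄_nat_one_mod_four h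
  have hs : ∀ i b : ℕ, chiSum (p ^ (2 * i + b)) = 2 * (i : ℤ) + (b + 1) := by
    intro i b
    rw [chiSum_prime_pow hp, hc]
    simp; ring
  rcases Nat.even_or_odd' e with ⟨L, rfl | rfl⟩
  · obtain ⟨l, rfl⟩ : ∃ l, L = l + 1 := ⟨L - 1, by omega⟩
    rw [twinConv_prime_pow hp (e := 2 * (l + 1)) (l + 1) 0 two_pos rfl]
    simp only [hs]
    rw [weighted_sum_twistedTotient hp h, twinG, if_pos (even_two_mul _),
      Nat.mul_div_cancel_left _ two_pos, Nat.add_sub_cancel, Nat.cast_add, sigma_prime_pow_cast hp,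
      sigma_prime_pow_cast hp, Finset.sum_range_succ _ (l + 1)]
    push_cast; ring
  · rw [twinConv_prime_pow hp L 1 one_lt_two rfl]
    simp only [hs]
    rw [weighted_sum_twistedTotient hp h, twinG,
      if_neg (Nat.not_even_iff_odd.mpr (odd_two_mul_add_one _)),
      show (2 * L + 1) / 2 = L by omega, Nat.cast_mul, sigma_prime_pow_cast hp,
      Finset.sum_range_succ _ L]
    push_cast; ring

theorem twinConv_inert {q : ℕ} (hq : q.Prime) (h : q % 4 = 3) {e : ℕ} (he : 0 < e) :
    twinConv (q ^ e) = twinH q e := by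
  have hc : chiFour q = -1 := ZMod.χ₄_nat_three_mod_four h
  have hodd : Odd q := Nat.odd_iff.mpr (Nat.odd_of_mod_four_eq_three h)
  have hs : ∀ i, chiSum (q ^ i) = if Even (i + 1) then 0 else 1 := by
    intro i
    rw [chiSum_prime_pow hq, hc, neg_one_geom_sum]
  rcases Nat.even_or_odd' e with ⟨L, rfl | rfl⟩
  · obtain ⟨l, rfl⟩ : ∃ l, L = l + 1 := ⟨L - 1, by omega⟩
    have key : ∀ l : ℕ, ∑ j ∈ Finset.range (l + 1 + 1), twistedTotient (q ^ j) =
        ∑ j ∈ Finset.range (l + 1 + 1), (q : ℤ) ^ j + ∑ j ∈ Finset.range (l + 1), (q : ℤ) ^ j := by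
      intro l
      rw [Finset.sum_range_succ', Finset.sum_range_succ' (fun j => (q : ℤ) ^ j) (l + 1), pow_zero,
        isMultiplicative_twistedTotient.map_one, add_right_comm, ← Finset.sum_add_distrib]
      refine congrArg₂ _ (Finset.sum_congr rfl fun j _ => ?_) (pow_zero _).symm
      rw [twistedTotient_odd_prime_pow hq hodd, hc]; ring
    rw [twinConv_prime_pow hq (e := 2 * (l + 1)) (l + 1) 0 two_pos rfl, twinH,
      if_pos (even_two_mul _), Nat.mul_div_cancel_left _ two_pos, Nat.add_sub_cancel, Nat.cast_add,
      sigma_prime_pow_cast hq, sigma_prime_pow_cast hq, ← key]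
    refine Finset.sum_congr rfl fun j _ => ?_
    rw [hs, add_zero, if_neg (Nat.not_even_iff_odd.mpr (odd_two_mul_add_one _)), mul_one]
  · rw [twinConv_prime_pow hq L 1 one_lt_two rfl, twinH,
      if_neg (Nat.not_even_iff_odd.mpr (odd_two_mul_add_one _))]
    refine Finset.sum_eq_zero fun j _ => ?_
    rw [hs, if_pos (odd_two_mul_add_one _).add_one, mul_zero]

/-! ### The number of twin pairs -/

theorem twinConv_factored {m l : ℕ} (κ : ℕ) (p lam : Fin m → ℕ) (q mu : Fin l → ℕ)
    (hpi : Function.Injective p) (hqi : Function.Injective q)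
    (hp : ∀ r, (p r).Prime ∧ p r % 4 = 1 ∧ 0 < lam r)
    (hq : ∀ s, (q s).Prime ∧ q s % 4 = 3 ∧ 0 < mu s) :
    twinConv (2 ^ κ * (∏ r, p r ^ lam r) * (∏ s, q s ^ mu s)) =
      (∏ r, (twinG (p r) (lam r) : ℤ)) * (∏ s, (twinH (q s) (mu s) : ℤ)) := by
  have hmul := isMultiplicative_twinConv
  have hcop : ∀ {a b : ℕ} (i j : ℕ), a.Prime → b.Prime → a ≠ b → (a ^ i).Coprime (b ^ j) :=
    fun i j ha hb hab => Nat.Coprime.pow i j ((Nat.coprime_primes ha hb).mpr hab)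
  have h1 : (2 ^ κ).Coprime (∏ r, p r ^ lam r) := Nat.Coprime.prod_right fun r _ =>
    hcop _ _ Nat.prime_two (hp r).1 (by have := (hp r).2.1; omega)
  have h2 : (2 ^ κ * ∏ r, p r ^ lam r).Coprime (∏ s, q s ^ mu s) := by
    refine Nat.Coprime.prod_right fun s _ =>
      Nat.Coprime.mul_left ?_ (Nat.Coprime.prod_left fun r _ => ?_)
    · exact hcop _ _ Nat.prime_two (hq s).1 (by have := (hq s).2.1; omega)
    · refine hcop _ _ (hp r).1 (hq s).1 ?_
      have := (hp r).2.1
      have := (hq s).2.1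
      omega
  rw [hmul.map_mul_of_coprime h2, hmul.map_mul_of_coprime h1, twinConv_two_pow, one_mul,
    hmul.map_prod _ _ fun r _ r' _ hr => hcop _ _ (hp r).1 (hp r').1 (hpi.ne hr),
    hmul.map_prod _ _ fun s _ s' _ hs => hcop _ _ (hq s).1 (hq s').1 (hqi.ne hs)]
  congr 1
  · exact Finset.prod_congr rfl fun r _ => twinConv_split (hp r).1 (hp r).2.1 (hp r).2.2
  · exact Finset.prod_congr rfl fun s _ => twinConv_inert (hq s).1 (hq s).2.1 (hq s).2.2

theorem sum_two_squares_of_twinConv_ne_zero {M : ℕ} (h : twinConv M ≠ 0) :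
    ∃ a b : ℤ, (M : ℤ) = a ^ 2 + b ^ 2 := by
  rw [twinConv, ArithmeticFunction.mul_apply] at h
  obtain ⟨⟨a, b⟩, hab, hne⟩ := Finset.exists_ne_zero_of_sum_ne_zero h
  obtain ⟨ha, hb⟩ := mul_ne_zero_iff.mp hne
  obtain ⟨rfl, hM⟩ := Nat.mem_divisorsAntidiagonal.mp hab
  have hsq : IsSquare b := by
    by_contra hb'
    exact hb (onSquares_of_not_isSquare _ hb')
  obtain ⟨k, rfl⟩ := hsq
  have hc : normCount a ≠ 0 := by
    have := normCount_eq a (left_ne_zero_of_mul hM)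
    intro h0
    rw [h0] at this
    exact ha (by push_cast at this; linarith)
  obtain ⟨z, hz⟩ := Set.nonempty_of_ncard_ne_zero hc
  have hz : gnorm z = a := hz
  refine ⟨z.re * k, z.im * k, ?_⟩
  push_cast
  rw [← hz, gnorm_cast']; ring

theorem theorem5p10 :
    -- for every positive `M` there are only finitely many twin pairs of norm `M`
    (∀ M : ℕ, 0 < M → (twinPairs M).Finite) ∧
    -- the formula for their number, in terms of the prime factorization of `M`
    (∀ (M κ m l : ℕ) (p lam : Fin m → ℕ) (q mu : Fin l → ℕ),
      Function.Injective p → Function.Injective q →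
      (∀ r, (p r).Prime ∧ p r % 4 = 1 ∧ 0 < lam r) →
      (∀ s, (q s).Prime ∧ q s % 4 = 3 ∧ 0 < mu s) →
      M = 2 ^ κ * (∏ r, p r ^ lam r) * (∏ s, q s ^ mu s) →
      Twin M = 24 * (∏ r, twinG (p r) (lam r)) * (∏ s, twinH (q s) (mu s))) ∧
    -- `Twin M / 24` is multiplicative
    twinDiv24.IsMultiplicative ∧
    -- the norm of a twin pair is a sum of two squares
    (∀ M : ℕ, 0 < M → (∃ θ η : ℍ[ℤ], IsTwinPair θ η ∧
        Quaternion.normSq θ = (M : ℤ) ∧ Quaternion.normSq η = (M : ℤ)) →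
      ∃ a b : ℤ, (M : ℤ) = a ^ 2 + b ^ 2) := by
  refine ⟨fun M hM => (twin_finite_and_eq hM.ne').1, ?_, ?_, ?_⟩
  · rintro M κ m l p lam q mu hpi hqi hp hq hM
    have hM0 : M ≠ 0 := by
      rw [hM]
      exact mul_ne_zero (mul_ne_zero (pow_ne_zero _ two_ne_zero)
        (Finset.prod_ne_zero_iff.mpr fun r _ => pow_ne_zero _ (hp r).1.ne_zero))
        (Finset.prod_ne_zero_iff.mpr fun s _ => pow_ne_zero _ (hq s).1.ne_zero)
    have h := (twin_finite_and_eq hM0).2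
    rw [hM, twinConv_factored κ p lam q mu hpi hqi hp hq, ← hM] at h
    zify
    rw [h]; ring
  · have h : ∀ n, n ≠ 0 → twinDiv24 n = (twinConv n : ℚ) := by
      intro n hn
      have h1 : ((Twin n : ℤ) : ℚ) = _ := congrArg Int.cast (twin_finite_and_eq hn).2
      change (Twin n : ℚ) / 24 = _
      push_cast at h1
      rw [h1]; ring
    rw [ArithmeticFunction.IsMultiplicative.iff_ne_zero]
    refine ⟨by rw [h 1 one_ne_zero, isMultiplicative_twinConv.map_one]; simp, ?_⟩
    intro m n hm hn hmn
    rw [h _ (mul_ne_zero hm hn), h m hm, h n hn, isMultiplicative_twinConv.map_mul_of_coprime hmn]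
    push_cast; rfl
  · rintro M hM ⟨θ, η, h1, h2, h3⟩
    refine sum_two_squares_of_twinConv_ne_zero fun h0 => ?_
    obtain ⟨hfin, h⟩ := twin_finite_and_eq hM.ne'
    rw [h0, mul_zero, Nat.cast_eq_zero, Twin, Set.ncard_eq_zero hfin] at h
    have : (θ, η) ∈ twinPairs M := ⟨h1, h2, h3⟩
    rw [h] at this
    exact this
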